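/- Let $d\ge 2$, let $I\subset\mathbb{R}$ be a closed interval of positive length (for instance $I=[0,1]$ or $I=\mathbb{R}$), and let $\gamma_1,\dots,\gamma_{d-1}:I\to\mathbb{R}$ be $C^\infty$ functions such that the curve $$\Gamma=\{\Gamma(s)=(s,\gamma_1(s),\dots,\gamma_{d-1}(s)):\ s\in I\}\subset\mathbb{R}^d$$ has non-vanishing curvature and torsion, i.e. for every $s\in I$ the vectors $\Gamma'(s),\Gamma''(s),\dots,\Gamma^{(d)}(s)$ are linearly independent (derivatives being one-sided at the endpoints of $I$). For $1\le l\le d-1$ and $x,y\in\mathbb{R}^d$ with $x_1-y_1\in I$ put $$\phi_l(x,y)=(x_{l+1}-y_{l+1})-\gamma_l(x_1-y_1).$$ Let $E\subset\mathbb{R}^d$ be compact and Ahlfors-David regular: there are a Borel measure $\mu$ with $\mu(\mathbb{R}^d\setminus E)=0$ and a constant $C>0$ such that $C^{-1}\delta^{\alpha}\le\mu(B_\delta(x))\le C\delta^{\alpha}$ for all $x\in E$ and $0<\delta\le 1$, where $\alpha=\dim_{\mathcal H}(E)$ is the Hausdorff dimension of $E$ and $B_\delta(x)$ is the closed ball of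 radius $\delta$ centered at $x$. If $\dim_{\mathcal H}(E)>d-\frac1d$, then for every $t=(t_1,\dots,t_{d-1})\in\mathbb{R}^{d-1}$ the set $$S_t(E)=\{(x,y)\in E\times E:\ x_1-y_1\in I,\ \phi_l(x,y)=t_l \text{ for } 1\le l\le d-1\}$$ has upper Minkowski dimension $$\overline{\dim}_{\mathcal M}\,S_t(E)\le 2\dim_{\mathcal H}(E)-(d-1).$$ Here the upper Minkowski dimension of a bounded set $A$ is $\limsup_{\varepsilon\to0^+}\log N(A,\varepsilon)/\log(1/\varepsilon)$, where $N(A,\varepsilon)$ is the least number of closed balls of radius $\varepsilon$ centered in $A$ that cover $A$ (and it is $-\infty$ for $A=\emptyset$). -/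

import Mathlib

open scoped ContDiff ENNReal NNReal Topology

/-- Upper Minkowski (box) dimension of a set in a metric space,
`limsup_{ε → 0+} log N(A, ε) / log (1 / ε)`, where `N(A, ε)` is the least number of closed
`ε`-balls centred in `A` that cover `A`. It takes values in `[-∞, ∞]`
(`-∞` exactly for the empty set). -/
noncomputable def upperMinkowskiDim {X : Type*} [PseudoEMetricSpace X] (A : Set X) : EReal :=
  Filter.limsup
    (fun ε : ℝ≥0 =>
      ENNReal.log ((Metric.coveringNumber ε A : ℕ∞) : ℝ≥0∞) / ((Real.log (1 / (ε : ℝ)) : ℝ) : EReal))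
    (𝓝[>] 0)

/-- Ahlfors-David regularity: there is a Borel measure `μ` carried by `E` such that
`C⁻¹ δ ^ s ≤ μ (B(x, δ)) ≤ C δ ^ s` for all `x ∈ E` and all radii `0 < δ ≤ 1`, where `s` is the
Hausdorff dimension of `E`. (For a bounded set the lower bound cannot be asked at arbitrarily
large radii.) -/
def IsAhlforsDavidRegular {X : Type*} [MetricSpace X] [MeasurableSpace X] [BorelSpace X]
    (E : Set X) : Prop :=
  ∃ μ : MeasureTheory.Measure X, μ Eᶜ = 0 ∧ ∃ C : ℝ, 0 < C ∧
    ∀ x ∈ E, ∀ δ : ℝ, 0 < δ → δ ≤ 1 →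
      ENNReal.ofReal (C⁻¹ * δ ^ (dimH E).toReal) ≤ μ (Metric.closedBall x δ) ∧
      μ (Metric.closedBall x δ) ≤ ENNReal.ofReal (C * δ ^ (dimH E).toReal)

/-- The curve `Γ(s) = (s, γ₁(s), …, γₘ(s))` in `ℝ ^ (m + 1)`. -/
noncomputable def graphCurve {m : ℕ} (γ : Fin m → ℝ → ℝ) (s : ℝ) :
    EuclideanSpace ℝ (Fin (m + 1)) :=
  WithLp.toLp 2 (Fin.cons s (fun l => γ l s) : Fin (m + 1) → ℝ)

/-- Non-vanishing curvature and torsion of a curve `Γ : I → ℝ ^ d`: at every `s ∈ I` the first `d`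
derivatives `Γ'(s), …, Γ^(d)(s)` are linearly independent. For `d = 2` this says that the curvature
does not vanish, for `d = 3` that curvature and torsion do not vanish, and for general `d` that
none of the `d - 1` Frenet curvatures vanishes. -/
def HasNonvanishingCurvatureAndTorsionOn {d : ℕ} (Γ : ℝ → EuclideanSpace ℝ (Fin d))
    (I : Set ℝ) : Prop :=
  ∀ s ∈ I, LinearIndependent ℝ (fun k : Fin d => iteratedDerivWithin (k.val + 1) Γ I s)

/-- The function `φ_l(x, y) = (x_{l+1} - y_{l+1}) - γ_l(x_1 - y_1)`. Coordinates are numbered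
from `0` here, so that `x 0` is the first coordinate. -/
noncomputable def curvePhi {m : ℕ} (γ : Fin m → ℝ → ℝ) (l : Fin m)
    (x y : EuclideanSpace ℝ (Fin (m + 1))) : ℝ :=
  (x l.succ - y l.succ) - γ l (x 0 - y 0)

/-- The set of pairs `(x, y) ∈ E × E` with `φ_l(x, y) = t_l` for all `l`, where the `γ_l` are
functions on `I`, so that the `φ_l` are defined where `x 0 - y 0 ∈ I`. -/
def curvePairs {m : ℕ} (I : Set ℝ) (γ : Fin m → ℝ → ℝ) (t : Fin m → ℝ)
    (E : Set (EuclideanSpace ℝ (Fin (m + 1)))) :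
    Set (EuclideanSpace ℝ (Fin (m + 1)) × EuclideanSpace ℝ (Fin (m + 1))) :=
  {p | p.1 ∈ E ∧ p.2 ∈ E ∧ p.1 0 - p.2 0 ∈ I ∧ ∀ l : Fin m, curvePhi γ l p.1 p.2 = t l}

/-! The conditions `φ_l(x, y) = t_l` say that `x - y` lies on the translate of `Γ` by `(0, t)`.
Translation changes no derivative of positive order, and boundedness of `E` leaves only a compact
piece of the curve in play. Let `ν` be the image of Lebesgue measure on that piece, and `d = m + 1`.
The proof bounds from both sides the quantity `T(R) = ∫∫∫ exp(-R² |x - y - z|²) dμ(x) dμ(y) dν(z)`,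
where `R = 2 ^ K`.

Upper bound. By the Gaussian Fourier formula, `R ^ d T(R)` is a constant times the integral of
`exp(-|ξ|² / 4R²) |μ̂(ξ)|²` against the conjugate of `ν̂(ξ)`. Linear independence of the first `d`
derivatives means that no direction `ξ` is orthogonal to all of them, so van der Corput's lemma
gives `|ν̂(ξ)| ≲ |ξ| ^ (-1/d)` (`exists_norm_curve_integral_le`). The upper regularity of `μ` bounds
its Gaussian energies, so that `|μ̂|²` has mass `≲ 2 ^ (k(d - α))` at frequencies `|ξ| ~ 2 ^ k`
(`exists_integral_exp_neg_dist_sq_le`). The dyadic sum of `2 ^ (k(d - α - 1/d))` converges because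
`α > d - 1/d`, whence `T(R) ≲ R ^ (-d)` (`exists_integral_exp_sub_sub_le`).

Lower bound. Around each pair of the set, a ball of radius `1/(2R)` has `μ × μ` mass `≳ R ^ (-2α)`
by lower regularity, and on it the integral in `z` is `≳ 1/R`, since the curve is Lipschitz
(`le_setIntegral_exp_of_near`). For `N` pairs that are `1/R`-separated these balls are disjoint, so
`N R ^ (-2α) R⁻¹ ≲ R ^ (-d)`, that is, `N ≲ R ^ (2α - d + 1)` (`exists_card_separated_pairs_le`).
Separated sets control covering numbers, which gives the dimension bound. -/

/-! ### Van der Corput's lemma -/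

/-- `f 0, f 1, f 2, …` are continuous on `[a, b]`, and each is the derivative of the preceding one
on `(a, b)`. -/
def IsDerivChainOn {E : Type*} [NormedAddCommGroup E] [NormedSpace ℝ E] (f : ℕ → ℝ → E)
    (a b : ℝ) : Prop :=
  ∀ k, ContinuousOn (f k) (Set.Icc a b) ∧ ∀ s ∈ Set.Ioo a b, HasDerivAt (f k) (f (k + 1) s) s

namespace IsDerivChainOn

variable {E : Type*} [NormedAddCommGroup E] [NormedSpace ℝ E] {f : ℕ → ℝ → E} {a b : ℝ}

theorem mono (h : IsDerivChainOn f a b) {a' b' : ℝ} (ha : a ≤ a') (hb : b' ≤ b) :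
    IsDerivChainOn f a' b' :=
  fun k => ⟨(h k).1.mono (Set.Icc_subset_Icc ha hb),
    fun s hs => (h k).2 s (Set.Ioo_subset_Ioo ha hb hs)⟩

theorem neg (h : IsDerivChainOn f a b) : IsDerivChainOn (fun k s => -f k s) a b :=
  fun k => ⟨(h k).1.neg, fun s hs => ((h k).2 s hs).neg⟩

theorem intervalIntegrable (h : IsDerivChainOn f a b) (hab : a ≤ b) (k : ℕ) :
    IntervalIntegrable (f k) MeasureTheory.volume a b := by
  refine ContinuousOn.intervalIntegrable ?_
  rw [Set.uIcc_of_le hab]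
  exact (h k).1

theorem integral_eq_sub [CompleteSpace E] (h : IsDerivChainOn f a b) (hab : a ≤ b) (k : ℕ) :
    ∫ s in a..b, f (k + 1) s = f k b - f k a :=
  intervalIntegral.integral_eq_sub_of_hasDerivAt_of_le hab (h k).1 (h k).2
    (h.intervalIntegrable hab (k + 1))

end IsDerivChainOn

theorem norm_exp_ofReal_mul_I_le (x : ℝ) : ‖Complex.exp (x * Complex.I)‖ ≤ 1 :=
  (Complex.norm_exp_ofReal_mul_I x).le

theorem norm_oscillatory_integral_le {g : ℝ → ℝ} {a b : ℝ} (hab : a ≤ b) :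
    ‖∫ s in a..b, Complex.exp (g s * Complex.I)‖ ≤ b - a := by
  have h := intervalIntegral.norm_integral_le_of_norm_le_const (a := a) (b := b) (C := 1)
    (f := fun s => Complex.exp (g s * Complex.I)) fun s _ => norm_exp_ofReal_mul_I_le _
  rwa [one_mul, abs_of_nonneg (by linarith)] at h

/-- Negating the phase conjugates the integral. This reduces a derivative of either sign to the
positive case. -/
theorem norm_oscillatory_integral_neg {g : ℝ → ℝ} {a b : ℝ} :
    ‖∫ s in a..b, Complex.exp (((-g s : ℝ) : ℂ) * Complex.I)‖
      = ‖∫ s in a..b, Complex.exp (g s * Complex.I)‖ := by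
  have h : ∀ s, Complex.exp (((-g s : ℝ) : ℂ) * Complex.I)
      = (starRingEnd ℂ) (Complex.exp (g s * Complex.I)) := by
    intro s
    rw [← Complex.exp_conj]
    simp
  simp_rw [h]
  rw [intervalIntegral, intervalIntegral, integral_conj, integral_conj, ← map_sub,
    RCLike.norm_conj]

/-- Integration by parts for an oscillatory integral with non-stationary phase. -/
theorem norm_oscillatory_integral_le_add_integral {f : ℕ → ℝ → ℝ} {a b l : ℝ} (hab : a ≤ b)
    (hf : IsDerivChainOn f a b) (hl : 0 < l) (h1 : ∀ s ∈ Set.Icc a b, l ≤ f 1 s) :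
    ‖∫ s in a..b, Complex.exp (f 0 s * Complex.I)‖
      ≤ 2 / l + ∫ s in a..b, |f 2 s| / f 1 s ^ 2 := by
  have hpos : ∀ s ∈ Set.Icc a b, 0 < f 1 s := fun s hs => hl.trans_le (h1 s hs)
  have hne : ∀ s ∈ Set.Icc a b, (f 1 s : ℂ) ≠ 0 := fun s hs => by
    exact_mod_cast (hpos s hs).ne'
  have hc : ∀ k, ContinuousOn (fun s => (f k s : ℂ)) (Set.Icc a b) := fun k =>
    Complex.continuous_ofReal.comp_continuousOn (hf k).1
  have hce : ContinuousOn (fun s => Complex.exp (f 0 s * Complex.I)) (Set.Icc a b) :=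
    Complex.continuous_exp.comp_continuousOn ((hc 0).mul continuousOn_const)
  -- `u = exp(i f) / (i f')`, so that `u' = exp(i f) + r`.
  set u : ℝ → ℂ := fun s => -Complex.I * Complex.exp (f 0 s * Complex.I) / f 1 s with hu
  set r : ℝ → ℂ := fun s => Complex.I * Complex.exp (f 0 s * Complex.I) * f 2 s / (f 1 s : ℂ) ^ 2
    with hr
  have hcr : ContinuousOn r (Set.Icc a b) :=
    ((continuousOn_const.mul hce).mul (hc 2)).div ((hc 1).pow 2)
      fun s hs => pow_ne_zero 2 (hne s hs)
  have hcu : ContinuousOn u (Set.Icc a b) := (continuousOn_const.mul hce).div (hc 1) hne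
  have hder : ∀ s ∈ Set.Ioo a b,
      HasDerivAt u (Complex.exp (f 0 s * Complex.I) + r s) s := by
    intro s hs
    have hne' := hne s (Set.Ioo_subset_Icc_self hs)
    have d0 : HasDerivAt (fun s => (f 0 s : ℂ)) (f 1 s : ℂ) s := ((hf 0).2 s hs).ofReal_comp
    have d1 : HasDerivAt (fun s => (f 1 s : ℂ)) (f 2 s : ℂ) s := ((hf 1).2 s hs).ofReal_comp
    have d := (((d0.mul_const Complex.I).cexp).const_mul (-Complex.I)).div d1 hne'
    refine d.congr_deriv ?_
    simp only [hr]
    field_simp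
    linear_combination (-(f 1 s : ℂ) ^ 2) * Complex.I_sq
  have hint : ∀ g : ℝ → ℂ, ContinuousOn g (Set.Icc a b) →
      IntervalIntegrable g MeasureTheory.volume a b := fun g hg =>
    ContinuousOn.intervalIntegrable (by rwa [Set.uIcc_of_le hab])
  have hFTC := intervalIntegral.integral_eq_sub_of_hasDerivAt_of_le hab hcu hder
    (hint _ (hce.add hcr))
  rw [intervalIntegral.integral_add (hint _ hce) (hint _ hcr)] at hFTC
  have hub : ∀ s ∈ Set.Icc a b, ‖u s‖ ≤ 1 / l := by
    intro s hs
    simp only [hu, norm_div, norm_mul, norm_neg, Complex.norm_I, one_mul,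
      Complex.norm_exp_ofReal_mul_I, Complex.norm_real, Real.norm_eq_abs]
    rw [abs_of_pos (hpos s hs)]
    exact one_div_le_one_div_of_le hl (h1 s hs)
  have hrb : ‖∫ s in a..b, r s‖ ≤ ∫ s in a..b, |f 2 s| / f 1 s ^ 2 := by
    refine (intervalIntegral.norm_integral_le_integral_norm hab).trans (le_of_eq ?_)
    refine intervalIntegral.integral_congr fun s _ => ?_
    simp [hr, Complex.norm_exp_ofReal_mul_I]
  have heq : ∫ s in a..b, Complex.exp (f 0 s * Complex.I) = u b - u a - ∫ s in a..b, r s := by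
    rw [← hFTC]; ring
  rw [heq]
  have ha := hub a (Set.left_mem_Icc.2 hab)
  have hb := hub b (Set.right_mem_Icc.2 hab)
  have e : 2 / l = 1 / l + 1 / l := by ring
  calc _ ≤ ‖u b‖ + ‖u a‖ + ‖∫ s in a..b, r s‖ :=
        (norm_sub_le _ _).trans (by gcongr; exact norm_sub_le _ _)
    _ ≤ _ := by rw [e]; gcongr

theorem continuousOn_div_sq {f : ℕ → ℝ → ℝ} {a b l : ℝ}
    (hf : IsDerivChainOn f a b) (hl : 0 < l) (h1 : ∀ s ∈ Set.Icc a b, l ≤ f 1 s) :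
    ContinuousOn (fun s => f 2 s / f 1 s ^ 2) (Set.Icc a b) :=
  (hf 2).1.div ((hf 1).1.pow 2) fun s hs => pow_ne_zero 2 (hl.trans_le (h1 s hs)).ne'

/-- A bound on `f''` takes the place of monotonicity of `f'`. For phases linear in `ξ`, both `l` and
`M` scale like `|ξ|`, and then both terms are of order `|ξ|⁻¹`. -/
theorem norm_oscillatory_integral_le_of_deriv_of_bounded {f : ℕ → ℝ → ℝ} {a b l M : ℝ}
    (hab : a ≤ b) (hf : IsDerivChainOn f a b) (hl : 0 < l) (h1 : ∀ s ∈ Set.Icc a b, l ≤ f 1 s)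
    (h2 : ∀ s ∈ Set.Icc a b, |f 2 s| ≤ M) :
    ‖∫ s in a..b, Complex.exp (f 0 s * Complex.I)‖ ≤ 2 / l + M * (b - a) / l ^ 2 := by
  refine (norm_oscillatory_integral_le_add_integral hab hf hl h1).trans ?_
  gcongr
  have h := intervalIntegral.norm_integral_le_of_norm_le_const (a := a) (b := b) (C := M / l ^ 2)
    (f := fun s => |f 2 s| / f 1 s ^ 2) ?_
  · rw [abs_of_nonneg (by linarith : 0 ≤ b - a)] at h
    calc _ ≤ _ := le_abs_self _
      _ ≤ _ := h
      _ = _ := by ring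
  · intro s hs
    rw [Set.uIoc_of_le hab] at hs
    have hs' := Set.Ioc_subset_Icc_self hs
    have := h1 s hs'
    have := h2 s hs'
    rw [Real.norm_eq_abs, abs_div, abs_abs, abs_of_nonneg (by positivity : 0 ≤ f 1 s ^ 2)]
    gcongr
    exact (abs_nonneg _).trans this

/-- Since `f'' / f'²` is the derivative of `-1 / f'`, a constant sign lets the integral of its
absolute value be evaluated at the endpoints, at a cost of at most `1 / l`. -/
theorem norm_oscillatory_integral_le_of_deriv_of_signed {f : ℕ → ℝ → ℝ} {a b l : ℝ}
    (hab : a ≤ b) (hf : IsDerivChainOn f a b) (hl : 0 < l) (h1 : ∀ s ∈ Set.Icc a b, l ≤ f 1 s)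
    (h2 : (∀ s ∈ Set.Icc a b, 0 ≤ f 2 s) ∨ ∀ s ∈ Set.Icc a b, f 2 s ≤ 0) :
    ‖∫ s in a..b, Complex.exp (f 0 s * Complex.I)‖ ≤ 3 / l := by
  refine (norm_oscillatory_integral_le_add_integral hab hf hl h1).trans ?_
  have hpos : ∀ s ∈ Set.Icc a b, 0 < f 1 s := fun s hs => hl.trans_le (h1 s hs)
  have hF : ∫ s in a..b, f 2 s / f 1 s ^ 2 = (f 1 a)⁻¹ - (f 1 b)⁻¹ := by
    have hc : ContinuousOn (fun s => -(f 1 s)⁻¹) (Set.Icc a b) :=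
      ((hf 1).1.inv₀ fun s hs => (hpos s hs).ne').neg
    have := intervalIntegral.integral_eq_sub_of_hasDerivAt_of_le hab hc
      (f' := fun s => f 2 s / f 1 s ^ 2) (fun s hs => ?_)
      (ContinuousOn.intervalIntegrable (by
        rw [Set.uIcc_of_le hab]; exact continuousOn_div_sq hf hl h1))
    · rw [this]; ring
    · have d := (((hf 1).2 s hs).inv (hpos s (Set.Ioo_subset_Icc_self hs)).ne').neg
      refine d.congr_deriv ?_
      ring
  have hbound : ∀ s ∈ Set.Icc a b, 0 < (f 1 s)⁻¹ ∧ (f 1 s)⁻¹ ≤ 1 / l := fun s hs =>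
    ⟨inv_pos.2 (hpos s hs), by rw [one_div]; exact inv_anti₀ hl (h1 s hs)⟩
  have ba := hbound a (Set.left_mem_Icc.2 hab)
  have bb := hbound b (Set.right_mem_Icc.2 hab)
  have e : 3 / l = 2 / l + 1 / l := by ring
  rw [e]
  gcongr
  rcases h2 with h2 | h2
  · have : ∫ s in a..b, |f 2 s| / f 1 s ^ 2 = ∫ s in a..b, f 2 s / f 1 s ^ 2 :=
      intervalIntegral.integral_congr fun s hs => by
        rw [Set.uIcc_of_le hab] at hs
        simp only [abs_of_nonneg (h2 s hs)]
    rw [this, hF]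
    linarith
  · have : ∫ s in a..b, |f 2 s| / f 1 s ^ 2 = ∫ s in a..b, -(f 2 s / f 1 s ^ 2) :=
      intervalIntegral.integral_congr fun s hs => by
        rw [Set.uIcc_of_le hab] at hs
        simp only [abs_of_nonpos (h2 s hs), neg_div]
    rw [this, intervalIntegral.integral_neg, hF]
    linarith

/-- The constants `3, 8, 18, …` in van der Corput's lemma. -/
def vanDerCorputConst : ℕ → ℝ
  | 0 => 3
  | k + 1 => 2 * (1 + vanDerCorputConst k)

theorem vanDerCorputConst_pos : ∀ k, 0 < vanDerCorputConst k
  | 0 => by norm_num [vanDerCorputConst]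
  | k + 1 => by have := vanDerCorputConst_pos k; simp only [vanDerCorputConst]; positivity

/-- One step of van der Corput's lemma: away from a zero of the `k`-th derivative it is bounded
below. -/
theorem vanDerCorput_step {k : ℕ} (hk : 1 ≤ k) {C : ℝ} (hC : 0 < C)
    (ih : ∀ (f : ℕ → ℝ → ℝ) (a b l : ℝ), a ≤ b → IsDerivChainOn f a b → 0 < l →
      (∀ s ∈ Set.Icc a b, l ≤ f k s) →
      ((∀ s ∈ Set.Icc a b, 0 ≤ f (k + 1) s) ∨ ∀ s ∈ Set.Icc a b, f (k + 1) s ≤ 0) →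
      ‖∫ s in a..b, Complex.exp (f 0 s * Complex.I)‖ ≤ C * l ^ (-(1 / k : ℝ)))
    (f : ℕ → ℝ → ℝ) (a b l : ℝ) (hab : a ≤ b) (hf : IsDerivChainOn f a b) (hl : 0 < l)
    (h1 : ∀ s ∈ Set.Icc a b, l ≤ f (k + 1) s) :
    ‖∫ s in a..b, Complex.exp (f 0 s * Complex.I)‖
      ≤ 2 * (1 + C) * l ^ (-(1 / (k + 1 : ℕ) : ℝ)) := by
  have hk0 : (0 : ℝ) < k := by exact_mod_cast hk
  -- This `δ` solves `(l δ) ^ (-1/k) = δ`. It balances the trivial bound on a window of length `δ`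
  -- beside a zero of `f k` against the order-`k` bound outside, where `|f k| ≥ l δ`.
  set δ : ℝ := l ^ (-(1 / (k + 1 : ℕ) : ℝ)) with hδ
  have hδ0 : 0 < δ := Real.rpow_pos_of_pos hl _
  have hpow : (l * δ) ^ (-(1 / k : ℝ)) = δ := by
    have : l * δ = l ^ (1 + -(1 / (k + 1 : ℕ) : ℝ)) := by
      rw [Real.rpow_add hl, Real.rpow_one]
    rw [this, ← Real.rpow_mul hl.le, hδ]
    congr 1
    push_cast
    field_simp
    ring
  have hlδ : 0 < l * δ := mul_pos hl hδ0
  have hgrow : ∀ x ∈ Set.Icc a b, ∀ y ∈ Set.Icc a b, x ≤ y → l * (y - x) ≤ f k y - f k x := by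
    intro x hx y hy hxy
    have hch := hf.mono hx.1 hy.2
    rw [← hch.integral_eq_sub hxy k]
    have := intervalIntegral.integral_mono_on (f := fun _ => l) hxy (by simp)
      (hch.intervalIntegrable hxy (k + 1))
      fun s hs => h1 s (Set.Icc_subset_Icc hx.1 hy.2 hs)
    simp only [intervalIntegral.integral_const, smul_eq_mul] at this
    linarith
  have hint : ∀ x ∈ Set.Icc a b, ∀ y ∈ Set.Icc a b,
      IntervalIntegrable (fun s => Complex.exp (f 0 s * Complex.I)) MeasureTheory.volume x y := by
    intro x hx y hy
    refine ContinuousOn.intervalIntegrable ?_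
    refine Complex.continuous_exp.comp_continuousOn
      ((Complex.continuous_ofReal.comp_continuousOn ?_).mul continuousOn_const)
    exact (hf 0).1.mono (Set.uIcc_subset_Icc hx hy)
  -- the right of a zero
  have hright : ∀ z ∈ Set.Icc a b, 0 ≤ f k z →
      ‖∫ s in z..b, Complex.exp (f 0 s * Complex.I)‖ ≤ (1 + C) * δ := by
    intro z hz hfz
    rcases le_total (b - z) δ with h | h
    · refine (norm_oscillatory_integral_le hz.2).trans ?_
      nlinarith
    have hw : z + δ ∈ Set.Icc a b := ⟨by linarith [hz.1], by linarith⟩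
    have hb : b ∈ Set.Icc a b := Set.right_mem_Icc.2 hab
    rw [← intervalIntegral.integral_add_adjacent_intervals (hint z hz _ hw) (hint _ hw b hb)]
    have i1 := norm_oscillatory_integral_le (g := f 0) (a := z) (b := z + δ) (by linarith)
    have i2 := ih f (z + δ) b (l * δ) hw.2 (hf.mono hw.1 le_rfl) hlδ
      (fun s hs => by
        have hs' : s ∈ Set.Icc a b := ⟨hw.1.trans hs.1, hs.2⟩
        have := hgrow z hz s hs' (by linarith [hs.1])
        have : l * δ ≤ l * (s - z) := by
          have := hs.1
          gcongr
          linarith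
        linarith)
      (Or.inl fun s hs => hl.le.trans (h1 s ⟨hw.1.trans hs.1, hs.2⟩))
    rw [hpow] at i2
    refine (norm_add_le _ _).trans ?_
    linarith
  have hleft : ∀ z ∈ Set.Icc a b, f k z ≤ 0 →
      ‖∫ s in a..z, Complex.exp (f 0 s * Complex.I)‖ ≤ (1 + C) * δ := by
    intro z hz hfz
    rcases le_total (z - a) δ with h | h
    · refine (norm_oscillatory_integral_le hz.1).trans ?_
      nlinarith
    have hw : z - δ ∈ Set.Icc a b := ⟨by linarith, by linarith [hz.2]⟩
    have ha : a ∈ Set.Icc a b := Set.left_mem_Icc.2 hab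
    rw [← intervalIntegral.integral_add_adjacent_intervals (hint a ha _ hw) (hint _ hw z hz)]
    have i1 := norm_oscillatory_integral_le (g := f 0) (a := z - δ) (b := z) (by linarith)
    have i2 := ih (fun k s => -f k s) a (z - δ) (l * δ) hw.1 (hf.mono le_rfl hw.2).neg hlδ
      (fun s hs => by
        have hs' : s ∈ Set.Icc a b := ⟨hs.1, hs.2.trans hw.2⟩
        have := hgrow s hs' z hz (by linarith [hs.2])
        have : l * δ ≤ l * (z - s) := by
          have := hs.2
          gcongr
          linarith
        linarith)
      (Or.inr fun s hs => neg_nonpos.2 (hl.le.trans (h1 s ⟨hs.1, hs.2.trans hw.2⟩)))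
    rw [hpow, norm_oscillatory_integral_neg] at i2
    refine (norm_add_le _ _).trans ?_
    linarith
  -- If `f k` has no zero, an endpoint serves as `z` and one of the two integrals is empty.
  obtain ⟨z, hz, hz1, hz2⟩ : ∃ z ∈ Set.Icc a b, (0 ≤ f k z ∨ z = b) ∧ (f k z ≤ 0 ∨ z = a) := by
    have ha : a ∈ Set.Icc a b := Set.left_mem_Icc.2 hab
    have hb : b ∈ Set.Icc a b := Set.right_mem_Icc.2 hab
    rcases le_total 0 (f k a) with h | h
    · exact ⟨a, ha, Or.inl h, Or.inr rfl⟩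
    rcases le_total (f k b) 0 with h' | h'
    · exact ⟨b, hb, Or.inr rfl, Or.inl h'⟩
    obtain ⟨z, hz, hz0⟩ := intermediate_value_Icc hab (hf k).1 ⟨h, h'⟩
    exact ⟨z, hz, Or.inl hz0.ge, Or.inl hz0.le⟩
  rw [← intervalIntegral.integral_add_adjacent_intervals
    (hint a (Set.left_mem_Icc.2 hab) z hz) (hint z hz b (Set.right_mem_Icc.2 hab))]
  have hnn : 0 ≤ (1 + C) * δ := by positivity
  have j1 : ‖∫ s in z..b, Complex.exp (f 0 s * Complex.I)‖ ≤ (1 + C) * δ := by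
    rcases hz1 with h | h
    · exact hright z hz h
    · subst h; simpa using hnn
  have j2 : ‖∫ s in a..z, Complex.exp (f 0 s * Complex.I)‖ ≤ (1 + C) * δ := by
    rcases hz2 with h | h
    · exact hleft z hz h
    · subst h; simpa using hnn
  refine (norm_add_le _ _).trans ?_
  linarith

/-- The sign condition matters only for the first derivative. From the second on it is carried so
that the induction closes: the step supplies it to the lower order from the lower bound on the next
derivative. -/
theorem vanDerCorput_signed (k : ℕ) :
    ∀ (f : ℕ → ℝ → ℝ) (a b l : ℝ), a ≤ b → IsDerivChainOn f a b → 0 < l →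
      (∀ s ∈ Set.Icc a b, l ≤ f (k + 1) s) →
      ((∀ s ∈ Set.Icc a b, 0 ≤ f (k + 1 + 1) s) ∨ ∀ s ∈ Set.Icc a b, f (k + 1 + 1) s ≤ 0) →
      ‖∫ s in a..b, Complex.exp (f 0 s * Complex.I)‖
        ≤ vanDerCorputConst k * l ^ (-(1 / (k + 1 : ℕ) : ℝ)) := by
  induction k with
  | zero =>
    intro f a b l hab hf hl h1 h2
    have := norm_oscillatory_integral_le_of_deriv_of_signed hab hf hl h1 h2
    simpa [vanDerCorputConst, Real.rpow_neg_one, div_eq_mul_inv] using this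
  | succ k ih =>
    intro f a b l hab hf hl h1 _
    exact vanDerCorput_step (Nat.le_add_left 1 k) (vanDerCorputConst_pos k) ih f a b l hab hf hl h1

/-- Van der Corput's lemma for derivatives of order at least two. -/
theorem vanDerCorput (k : ℕ) (f : ℕ → ℝ → ℝ) (a b l : ℝ) (hab : a ≤ b)
    (hf : IsDerivChainOn f a b) (hl : 0 < l) (h1 : ∀ s ∈ Set.Icc a b, l ≤ f (k + 2) s) :
    ‖∫ s in a..b, Complex.exp (f 0 s * Complex.I)‖
      ≤ vanDerCorputConst (k + 1) * l ^ (-(1 / (k + 2 : ℕ) : ℝ)) :=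
  vanDerCorput_step (Nat.le_add_left 1 k) (vanDerCorputConst_pos k) (vanDerCorput_signed k)
    f a b l hab hf hl h1

/-! ### Fourier decay of non-degenerate curves -/

section CurveDecay

variable {V : Type*} [NormedAddCommGroup V] [InnerProductSpace ℝ V]

theorem IsDerivChainOn.inner_right {F : ℕ → ℝ → V} {a b : ℝ} (hF : IsDerivChainOn F a b) (ξ : V) :
    IsDerivChainOn (fun k s => inner ℝ (F k s) ξ) a b := by
  refine fun k => ⟨(hF k).1.inner continuousOn_const, fun s hs => ?_⟩
  have := ((hF k).2 s hs).inner ℝ (hasDerivAt_const s ξ)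
  simpa using this

/-- The derivatives span, so no unit vector is orthogonal to all of them. The sum of the absolute
inner products is thus positive on the compact set of pairs (parameter, unit vector), and pigeonhole
picks one large term. -/
theorem exists_pos_forall_exists_le_abs_inner [FiniteDimensional ℝ V] {F : ℕ → ℝ → V} {a b : ℝ}
    (hF : ∀ k, ContinuousOn (F k) (Set.Icc a b)) {d : ℕ} (hd : Module.finrank ℝ V = d)
    (hli : ∀ s ∈ Set.Icc a b, LinearIndependent ℝ (fun k : Fin d => F (k.val + 1) s)) :
    ∃ c : ℝ, 0 < c ∧ ∀ s ∈ Set.Icc a b, ∀ ξ : V, ξ ≠ 0 →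
      ∃ k < d, c * ‖ξ‖ ≤ |inner ℝ (F (k + 1) s) ξ| := by
  set m : ℝ × V → ℝ := fun p => ∑ k : Fin d, |inner ℝ (F (k.val + 1) p.1) p.2| with hm
  have hcont : ContinuousOn m (Set.Icc a b ×ˢ Metric.sphere (0 : V) 1) := by
    refine continuousOn_finsetSum _ fun k _ => ?_
    refine ContinuousOn.abs (ContinuousOn.inner ?_ continuousOn_snd)
    exact (hF _).comp continuousOn_fst fun p hp => hp.1
  have hpos : ∀ p ∈ Set.Icc a b ×ˢ Metric.sphere (0 : V) 1, 0 < m p := by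
    rintro ⟨s, θ⟩ ⟨hs, hθ⟩
    have hθ0 : θ ≠ 0 := by
      rintro rfl
      simp at hθ
    by_contra hle
    have h0 : ∀ k : Fin d, inner ℝ (F (k.val + 1) s) θ = 0 := by
      have hz : m (s, θ) = 0 :=
        le_antisymm (not_lt.1 hle) (Finset.sum_nonneg fun _ _ => abs_nonneg _)
      have := (Finset.sum_eq_zero_iff_of_nonneg fun _ _ => abs_nonneg _).1 hz
      exact fun k => abs_eq_zero.1 (this k (Finset.mem_univ k))
    have hspan : Submodule.span ℝ (Set.range fun k : Fin d => F (k.val + 1) s) = ⊤ :=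
      (hli s hs).span_eq_top_of_card_eq_finrank' (by simp [hd])
    have hmem : θ ∈ Submodule.span ℝ (Set.range fun k : Fin d => F (k.val + 1) s) := by
      rw [hspan]; trivial
    have : ∀ v ∈ Submodule.span ℝ (Set.range fun k : Fin d => F (k.val + 1) s),
        inner ℝ v θ = 0 := by
      intro v hv
      induction hv using Submodule.span_induction with
      | mem x hx => obtain ⟨k, rfl⟩ := hx; exact h0 k
      | zero => simp
      | add x y _ _ hx hy => rw [inner_add_left, hx, hy, add_zero]
      | smul r x _ hx => rw [inner_smul_left, hx, mul_zero]
    exact hθ0 (inner_self_eq_zero.1 (this θ hmem))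
  have hcpt : IsCompact (Set.Icc a b ×ˢ Metric.sphere (0 : V) 1) :=
    isCompact_Icc.prod (isCompact_sphere 0 1)
  obtain ⟨c, hc0, hc⟩ : ∃ c : ℝ, 0 < c ∧ ∀ p ∈ Set.Icc a b ×ˢ Metric.sphere (0 : V) 1, c ≤ m p := by
    rcases (Set.Icc a b ×ˢ Metric.sphere (0 : V) 1).eq_empty_or_nonempty with he | hne
    · exact ⟨1, one_pos, by simp [he]⟩
    · obtain ⟨p, hp, hmin⟩ := hcpt.exists_isMinOn hne hcont
      exact ⟨m p, hpos p hp, fun q hq => hmin hq⟩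
  -- Dividing by `d + 1` rather than `d` makes `d` small terms add up to strictly less than `c`.
  refine ⟨c / (d + 1), by positivity, fun s hs ξ hξ => ?_⟩
  by_contra! hlt
  have hξ0 : 0 < ‖ξ‖ := norm_pos_iff.2 hξ
  have h1 := hc (s, ‖ξ‖⁻¹ • ξ) ⟨hs, by
    simp [norm_smul, hξ0.ne']⟩
  have h2 : m (s, ‖ξ‖⁻¹ • ξ) ≤ ∑ _k : Fin d, c / (d + 1) := by
    refine Finset.sum_le_sum fun k _ => ?_
    have := (hlt k k.2).le
    simp only [inner_smul_right]
    rw [abs_mul, abs_of_pos (inv_pos.2 hξ0), inv_mul_le_iff₀ hξ0, mul_comm ‖ξ‖]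
    exact this
  simp only [Finset.sum_const, Finset.card_univ, Fintype.card_fin, nsmul_eq_mul] at h2
  have h3 : (d : ℝ) * (c / (d + 1)) < c := by
    rw [← mul_div_assoc, div_lt_iff₀ (by positivity)]
    nlinarith
  linarith

/-- On an interval where one derivative dominates, van der Corput's lemma gives decay. -/
theorem norm_oscillatory_integral_le_of_short {F : ℕ → ℝ → V} {a b c M L : ℝ} (hab : a ≤ b)
    (hF : IsDerivChainOn F a b) {d : ℕ} (hc : 0 < c)
    (hM : ∀ k ≤ d + 1, ∀ s ∈ Set.Icc a b, ‖F k s‖ ≤ M)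
    (hshort : M * (b - a) ≤ c / 2) (hL : b - a ≤ L) {ξ : V} (hξ : 1 ≤ ‖ξ‖)
    {k : ℕ} (hk : k < d) (hlow : c * ‖ξ‖ ≤ |inner ℝ (F (k + 1) a) ξ|) :
    ‖∫ s in a..b, Complex.exp ((inner ℝ (F 0 s) ξ : ℝ) * Complex.I)‖
      ≤ (2 / (c / 2) + M * L / (c / 2) ^ 2
          + ∑ j ∈ Finset.range d, vanDerCorputConst j * (c / 2) ^ (-(1 / (j + 1 : ℕ) : ℝ)))
        * ‖ξ‖ ^ (-(1 / d : ℝ)) := by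
  have ha : a ∈ Set.Icc a b := Set.left_mem_Icc.2 hab
  have hM0 : 0 ≤ M := (norm_nonneg _).trans (hM 0 (Nat.zero_le _) a ha)
  have hξ0 : 0 < ‖ξ‖ := one_pos.trans_le hξ
  have hL0 : 0 ≤ L := (sub_nonneg.2 hab).trans hL
  have hl : 0 < c / 2 * ‖ξ‖ := by positivity
  set S := ∑ j ∈ Finset.range d, vanDerCorputConst j * (c / 2) ^ (-(1 / (j + 1 : ℕ) : ℝ)) with hS
  have hterm : ∀ j, 0 ≤ vanDerCorputConst j * (c / 2) ^ (-(1 / (j + 1 : ℕ) : ℝ)) := fun j =>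
    mul_nonneg (vanDerCorputConst_pos j).le (Real.rpow_nonneg (by positivity) _)
  have hS0 : 0 ≤ S := Finset.sum_nonneg fun j _ => hterm j
  have hd0 : (0 : ℝ) < d := by exact_mod_cast (Nat.zero_le k).trans_lt hk
  have hpow : ∀ j < d, ‖ξ‖ ^ (-(1 / (j + 1 : ℕ) : ℝ)) ≤ ‖ξ‖ ^ (-(1 / d : ℝ)) := by
    intro j hj
    refine Real.rpow_le_rpow_of_exponent_le hξ (neg_le_neg ?_)
    exact one_div_le_one_div_of_le (by positivity) (by exact_mod_cast hj)
  -- the case of a positive sign, for a general phase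
  have main : ∀ f : ℕ → ℝ → ℝ, IsDerivChainOn f a b →
      (∀ s ∈ Set.Icc a b, c / 2 * ‖ξ‖ ≤ f (k + 1) s) → (∀ s ∈ Set.Icc a b, |f 2 s| ≤ M * ‖ξ‖) →
      ‖∫ s in a..b, Complex.exp (f 0 s * Complex.I)‖
        ≤ (2 / (c / 2) + M * L / (c / 2) ^ 2 + S) * ‖ξ‖ ^ (-(1 / d : ℝ)) := by
    intro f hf h1 h2
    rcases k with _ | k
    · have h := norm_oscillatory_integral_le_of_deriv_of_bounded hab hf hl h1 h2
      have hp := hpow 0 hk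
      simp only [zero_add, Nat.cast_one, div_one, Real.rpow_neg_one] at hp
      calc _ ≤ _ := h
        _ = (2 / (c / 2) + M * (b - a) / (c / 2) ^ 2) * ‖ξ‖⁻¹ := by field_simp
        _ ≤ (2 / (c / 2) + M * L / (c / 2) ^ 2 + S) * ‖ξ‖⁻¹ := by
          refine mul_le_mul_of_nonneg_right ?_ (inv_nonneg.2 hξ0.le)
          have : M * (b - a) / (c / 2) ^ 2 ≤ M * L / (c / 2) ^ 2 := by gcongr
          linarith
        _ ≤ _ := by gcongr
    · have h := vanDerCorput k f a b _ hab hf hl h1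
      rw [Real.mul_rpow (by positivity) hξ0.le, ← mul_assoc] at h
      have hle : vanDerCorputConst (k + 1) * (c / 2) ^ (-(1 / (k + 1 + 1 : ℕ) : ℝ)) ≤ S :=
        Finset.single_le_sum (fun j _ => hterm j) (Finset.mem_range.2 hk)
      have hp := hpow (k + 1) hk
      have hrest : 0 ≤ 2 / (c / 2) + M * L / (c / 2) ^ 2 := by positivity
      refine h.trans ?_
      gcongr
      linarith
  have hg := hF.inner_right ξ
  have hg2 : ∀ s ∈ Set.Icc a b, |(inner ℝ (F 2 s) ξ : ℝ)| ≤ M * ‖ξ‖ := by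
    intro s hs
    have : (2 : ℕ) ≤ d + 1 := by omega
    exact (abs_real_inner_le_norm _ _).trans (by gcongr; exact hM 2 this s hs)
  -- On so short an interval the dominating derivative loses at most half of its initial size, hence
  -- keeps its sign.
  have hvar : ∀ s ∈ Set.Icc a b,
      |(inner ℝ (F (k + 1) s) ξ : ℝ) - inner ℝ (F (k + 1) a) ξ| ≤ c / 2 * ‖ξ‖ := by
    intro s hs
    rw [← (hg.mono le_rfl hs.2).integral_eq_sub hs.1 (k + 1)]
    have h := intervalIntegral.norm_integral_le_of_norm_le_const (a := a) (b := s)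
      (C := M * ‖ξ‖) (f := fun s => (inner ℝ (F (k + 1 + 1) s) ξ : ℝ)) fun x hx => by
        rw [Set.uIoc_of_le hs.1] at hx
        exact (abs_real_inner_le_norm _ _).trans
          (by gcongr; exact hM _ (by omega) x ⟨hx.1.le, hx.2.trans hs.2⟩)
    rw [abs_of_nonneg (sub_nonneg.2 hs.1)] at h
    refine h.trans ?_
    have : M * (s - a) ≤ M * (b - a) := by gcongr; exact hs.2
    nlinarith
  rcases le_total 0 (inner ℝ (F (k + 1) a) ξ : ℝ) with h0 | h0
  · rw [abs_of_nonneg h0] at hlow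
    refine main _ hg (fun s hs => ?_) hg2
    have := (abs_le.1 (hvar s hs)).1
    linarith
  · rw [abs_of_nonpos h0] at hlow
    rw [← norm_oscillatory_integral_neg]
    refine main _ hg.neg (fun s hs => ?_) (fun s hs => by rw [abs_neg]; exact hg2 s hs)
    have := (abs_le.1 (hvar s hs)).2
    linarith

/-- The Fourier transform of the arclength-type measure on a non-degenerate curve in a
`d`-dimensional space decays like `|ξ| ^ (-1/d)`. -/
theorem exists_norm_curve_integral_le [FiniteDimensional ℝ V] {F : ℕ → ℝ → V} {a b : ℝ}
    (hab : a ≤ b) (hF : IsDerivChainOn F a b) {d : ℕ} (hd : Module.finrank ℝ V = d)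
    (hli : ∀ s ∈ Set.Icc a b, LinearIndependent ℝ (fun k : Fin d => F (k.val + 1) s)) :
    ∃ C : ℝ, 0 < C ∧ ∀ ξ : V, 1 ≤ ‖ξ‖ →
      ‖∫ s in a..b, Complex.exp ((inner ℝ (F 0 s) ξ : ℝ) * Complex.I)‖
        ≤ C * ‖ξ‖ ^ (-(1 / d : ℝ)) := by
  obtain ⟨c, hc, hlow⟩ := exists_pos_forall_exists_le_abs_inner (fun k => (hF k).1) hd hli
  obtain ⟨M, hM0, hM⟩ : ∃ M : ℝ, 0 ≤ M ∧ ∀ k ≤ d + 1, ∀ s ∈ Set.Icc a b, ‖F k s‖ ≤ M := by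
    choose B hB using fun k => isCompact_Icc.exists_bound_of_continuousOn (hF k).1
    refine ⟨∑ k ∈ Finset.range (d + 2), |B k|, Finset.sum_nonneg fun _ _ => abs_nonneg _,
      fun k hk s hs => ?_⟩
    exact ((hB k s hs).trans (le_abs_self _)).trans
      (Finset.single_le_sum (f := fun k => |B k|) (fun _ _ => abs_nonneg _)
        (Finset.mem_range.2 (by omega)))
  -- With `n` equal pieces each has `M (b - a) / n ≤ c / 2`, whatever `ξ` is; only the dominating
  -- order depends on `ξ` and on the piece.
  obtain ⟨n, hn⟩ := exists_nat_gt (M * (b - a) / (c / 2))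
  have hn0 : (0 : ℝ) < n := lt_of_le_of_lt
    (div_nonneg (mul_nonneg hM0 (sub_nonneg.2 hab)) (by positivity)) hn
  set p : ℕ → ℝ := fun i => a + i * ((b - a) / n) with hp
  have hstep : 0 ≤ (b - a) / n := div_nonneg (sub_nonneg.2 hab) hn0.le
  have hp0 : p 0 = a := by simp [hp]
  have hpn : p n = b := by simp only [hp]; field_simp; ring
  have hpmono : Monotone p := by
    intro i j hij
    simp only [hp]
    gcongr
  have hpd : ∀ i, p (i + 1) - p i = (b - a) / n := by
    intro i; simp only [hp]; push_cast; ring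
  have hpm : ∀ i ≤ n, p i ∈ Set.Icc a b := fun i hi =>
    ⟨hp0 ▸ hpmono (Nat.zero_le i), hpn ▸ hpmono hi⟩
  set K := (2 / (c / 2) + M * (b - a) / (c / 2) ^ 2
          + ∑ j ∈ Finset.range d, vanDerCorputConst j * (c / 2) ^ (-(1 / (j + 1 : ℕ) : ℝ))) with hK
  have hK0 : 0 < K := by
    have h1 : 0 ≤ ∑ j ∈ Finset.range d, vanDerCorputConst j * (c / 2) ^ (-(1 / (j + 1 : ℕ) : ℝ)) :=
      Finset.sum_nonneg fun j _ =>
        mul_nonneg (vanDerCorputConst_pos j).le (Real.rpow_nonneg (by positivity) _)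
    have h2 : 0 ≤ M * (b - a) / (c / 2) ^ 2 :=
      div_nonneg (mul_nonneg hM0 (sub_nonneg.2 hab)) (by positivity)
    have h3 : 0 < 2 / (c / 2) := by positivity
    linarith
  refine ⟨n * K, by positivity, fun ξ hξ => ?_⟩
  have hξ' : ξ ≠ 0 := by
    rintro rfl
    norm_num at hξ
  have hcont : ContinuousOn (fun s => Complex.exp ((inner ℝ (F 0 s) ξ : ℝ) * Complex.I))
      (Set.Icc a b) :=
    Complex.continuous_exp.comp_continuousOn
      ((Complex.continuous_ofReal.comp_continuousOn
        ((hF 0).1.inner continuousOn_const)).mul continuousOn_const)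
  have hsum := intervalIntegral.sum_integral_adjacent_intervals (a := p) (n := n)
    (μ := MeasureTheory.volume)
    (f := fun s => Complex.exp ((inner ℝ (F 0 s) ξ : ℝ) * Complex.I)) fun i hi =>
      (hcont.mono (Set.uIcc_subset_Icc (hpm i hi.le) (hpm (i + 1) hi))).intervalIntegrable
  rw [hp0, hpn] at hsum
  rw [← hsum]
  refine (norm_sum_le _ _).trans ?_
  have hpiece : ∀ i ∈ Finset.range n,
      ‖∫ s in p i..p (i + 1), Complex.exp ((inner ℝ (F 0 s) ξ : ℝ) * Complex.I)‖
        ≤ K * ‖ξ‖ ^ (-(1 / d : ℝ)) := by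
    intro i hi
    have hi' := Finset.mem_range.1 hi
    obtain ⟨k, hk, hk'⟩ := hlow (p i) (hpm i hi'.le) ξ hξ'
    have hsub : Set.Icc (p i) (p (i + 1)) ⊆ Set.Icc a b :=
      Set.Icc_subset_Icc (hpm i hi'.le).1 (hpm (i + 1) hi').2
    refine norm_oscillatory_integral_le_of_short (hpmono (Nat.le_succ i))
      (hF.mono (hpm i hi'.le).1 (hpm (i + 1) hi').2) hc (fun k hk s hs => hM k hk s (hsub hs))
      ?_ ?_ hξ hk hk'
    · rw [hpd, ← mul_div_assoc, div_le_iff₀ hn0]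
      rw [div_lt_iff₀ (by positivity)] at hn
      linarith
    · linarith [(hpm i hi'.le).1, (hpm (i + 1) hi').2]
  refine (Finset.sum_le_sum hpiece).trans ?_
  simp [mul_assoc]

end CurveDecay

/-! ### Gaussian regularisation of pair correlations -/

section GaussianCorrelation

open MeasureTheory

variable {V : Type*} [NormedAddCommGroup V] [InnerProductSpace ℝ V] [FiniteDimensional ℝ V]
  [MeasurableSpace V] [BorelSpace V]

theorem integrable_exp_neg_norm_sq_div {q : ℝ} (hq : 0 < q) :
    Integrable (fun ξ : V => Real.exp (-(‖ξ‖ ^ 2 / (4 * q)))) := by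
  have hb : 0 < ((1 / (4 * q) : ℝ) : ℂ).re := by
    rw [Complex.ofReal_re]; positivity
  have h := (GaussianFourier.integrable_cexp_neg_mul_sq_norm_add hb 0 (0 : V)).re
  refine h.congr (Filter.Eventually.of_forall fun ξ => ?_)
  have e : (-((1 / (4 * q) : ℝ) : ℂ) * (‖ξ‖ : ℂ) ^ 2 + 0 * ((inner ℝ (0 : V) ξ : ℝ) : ℂ))
      = ((-(‖ξ‖ ^ 2 / (4 * q)) : ℝ) : ℂ) := by
    push_cast; ring
  simp only [e]
  exact Complex.exp_ofReal_re _

/-- Fubini moves the Fourier transform from `ρ` to the Gaussian, whose transform is again a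
Gaussian. -/
theorem integral_exp_neg_norm_sq_mul_charFun (ρ : Measure V) [IsFiniteMeasure ρ] {q : ℝ}
    (hq : 0 < q) :
    ∫ ξ : V, (Real.exp (-(‖ξ‖ ^ 2 / (4 * q))) : ℂ) * charFun ρ ξ
      = (((4 * Real.pi * q) ^ ((Module.finrank ℝ V : ℝ) / 2)
          * ∫ w, Real.exp (-(q * ‖w‖ ^ 2)) ∂ρ : ℝ) : ℂ) := by
  have hb : 0 < ((1 / (4 * q) : ℝ) : ℂ).re := by
    rw [Complex.ofReal_re]; positivity
  have hinner : ∀ w : V,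
      ∫ ξ : V, (Real.exp (-(‖ξ‖ ^ 2 / (4 * q))) : ℂ) * Complex.exp ((inner ℝ w ξ : ℝ) * Complex.I)
        = (((4 * Real.pi * q) ^ ((Module.finrank ℝ V : ℝ) / 2)
          * Real.exp (-(q * ‖w‖ ^ 2)) : ℝ) : ℂ) := by
    intro w
    have h := GaussianFourier.integral_cexp_neg_mul_sq_norm_add hb Complex.I w
    have e1 : ∀ ξ : V, (Real.exp (-(‖ξ‖ ^ 2 / (4 * q))) : ℂ)
        * Complex.exp ((inner ℝ w ξ : ℝ) * Complex.I)
        = Complex.exp (-((1 / (4 * q) : ℝ) : ℂ) * (‖ξ‖ : ℂ) ^ 2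
          + Complex.I * ((inner ℝ w ξ : ℝ) : ℂ)) := by
      intro ξ
      rw [Complex.exp_add, Complex.ofReal_exp]
      congr 2
      · push_cast; ring
      · ring
    simp_rw [e1]
    rw [h, Complex.ofReal_mul, Complex.ofReal_cpow (by positivity), Complex.ofReal_exp]
    have hqc : (q : ℂ) ≠ 0 := by exact_mod_cast hq.ne'
    congr 2
    · push_cast; field_simp
    · push_cast; ring
    · push_cast; field_simp; rw [Complex.I_sq]; ring
  have hcont : Continuous fun p : V × V => (Real.exp (-(‖p.1‖ ^ 2 / (4 * q))) : ℂ)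
      * Complex.exp ((inner ℝ p.2 p.1 : ℝ) * Complex.I) := by fun_prop
  have hint : Integrable (fun p : V × V => (Real.exp (-(‖p.1‖ ^ 2 / (4 * q))) : ℂ)
      * Complex.exp ((inner ℝ p.2 p.1 : ℝ) * Complex.I)) ((volume : Measure V).prod ρ) := by
    refine ((integrable_exp_neg_norm_sq_div hq).comp_fst ρ).mono'
      hcont.aestronglyMeasurable (Filter.Eventually.of_forall fun p => ?_)
    rw [norm_mul, Complex.norm_exp_ofReal_mul_I, mul_one, Complex.norm_real, Real.norm_eq_abs,
      abs_of_pos (Real.exp_pos _)]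
  simp_rw [charFun_apply, ← integral_const_mul]
  rw [integral_integral_swap hint]
  simp_rw [hinner]
  rw [integral_complex_ofReal, integral_const_mul]

theorem charFun_map_sub (μ ν : Measure V) [IsFiniteMeasure μ] [IsFiniteMeasure ν] (ξ : V) :
    charFun ((μ.prod ν).map fun p => p.1 - p.2) ξ
      = charFun μ ξ * (starRingEnd ℂ) (charFun ν ξ) := by
  rw [← charFun_neg, charFun_apply, charFun_apply, charFun_apply,
    integral_map (by fun_prop) (by fun_prop), ← integral_prod_mul]
  refine integral_congr_ae (Filter.Eventually.of_forall fun p => ?_)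
  simp only [inner_sub_left, inner_neg_right, ← Complex.exp_add]
  congr 1
  push_cast
  ring

/-- The Gaussian energy of `μ` in terms of its characteristic function. -/
theorem integral_exp_neg_mul_norm_charFun_sq (μ : Measure V) [IsFiniteMeasure μ] {q : ℝ}
    (hq : 0 < q) :
    ∫ ξ : V, Real.exp (-(‖ξ‖ ^ 2 / (4 * q))) * ‖charFun μ ξ‖ ^ 2
      = (4 * Real.pi * q) ^ ((Module.finrank ℝ V : ℝ) / 2)
        * ∫ p, Real.exp (-(q * ‖p.1 - p.2‖ ^ 2)) ∂(μ.prod μ) := by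
  have h := integral_exp_neg_norm_sq_mul_charFun ((μ.prod μ).map fun p => p.1 - p.2) hq
  rw [integral_map (by fun_prop) (by fun_prop)] at h
  have e : ∀ ξ : V, (Real.exp (-(‖ξ‖ ^ 2 / (4 * q))) : ℂ)
      * charFun ((μ.prod μ).map fun p => p.1 - p.2) ξ
      = ((Real.exp (-(‖ξ‖ ^ 2 / (4 * q))) * ‖charFun μ ξ‖ ^ 2 : ℝ) : ℂ) := by
    intro ξ
    rw [charFun_map_sub, Complex.mul_conj, Complex.normSq_eq_norm_sq]
    push_cast; ring
  simp_rw [e] at h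
  rw [integral_complex_ofReal] at h
  exact_mod_cast h

theorem integrable_exp_neg_mul_norm_charFun_sq (μ : Measure V) [IsFiniteMeasure μ] {q : ℝ}
    (hq : 0 < q) :
    Integrable fun ξ : V => Real.exp (-(‖ξ‖ ^ 2 / (4 * q))) * ‖charFun μ ξ‖ ^ 2 := by
  refine (integrable_exp_neg_norm_sq_div hq).mul_bdd (c := (μ.real Set.univ) ^ 2)
    (by fun_prop) (Filter.Eventually.of_forall fun ξ => ?_)
  rw [norm_pow, norm_norm]
  gcongr
  exact norm_charFun_le ξ

/-- The frequency side of the dyadic decomposition. -/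
theorem exp_neg_mul_le_sum_dyadic {β C N r : ℝ} (hβ : 0 ≤ β) (hC : 0 ≤ C) (hr : 0 ≤ r)
    (hN : N ≤ C) (hN' : 1 ≤ r → N ≤ C * r ^ (-β)) (K : ℕ) :
    Real.exp (-(r ^ 2 / (4 * 4 ^ K))) * N
      ≤ C * Real.exp 1 * ∑ k ∈ Finset.range (K + 1),
        ((2 : ℝ) ^ k) ^ (-β) * Real.exp (-(r ^ 2 / (4 * 4 ^ k))) := by
  have key : ∃ k ∈ Finset.range (K + 1), Real.exp (-(r ^ 2 / (4 * 4 ^ K))) * N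
      ≤ C * Real.exp 1 * (((2 : ℝ) ^ k) ^ (-β) * Real.exp (-(r ^ 2 / (4 * 4 ^ k)))) := by
    have hle1 : Real.exp (-(r ^ 2 / (4 * 4 ^ K))) ≤ 1 := Real.exp_le_one_iff.2 (by
      have : 0 ≤ r ^ 2 / (4 * 4 ^ K) := by positivity
      linarith)
    have hlow : ∀ k : ℕ, r ≤ 2 ^ (k + 1) → 1 ≤ Real.exp 1 * Real.exp (-(r ^ 2 / (4 * 4 ^ k))) := by
      intro k hk
      rw [← Real.exp_add]
      refine Real.one_le_exp ?_
      have : r ^ 2 / (4 * 4 ^ k) ≤ 1 := by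
        rw [div_le_one (by positivity)]
        calc r ^ 2 ≤ (2 ^ (k + 1)) ^ 2 := by gcongr
          _ = 4 * 4 ^ k := by
            rw [← pow_mul, mul_comm, pow_mul, pow_succ]; norm_num; ring
      linarith
    rcases le_total r 1 with h1 | h1
    · refine ⟨0, by simp, ?_⟩
      have := hlow 0 (by norm_num; linarith)
      calc _ ≤ Real.exp (-(r ^ 2 / (4 * 4 ^ K))) * C := by gcongr
        _ ≤ 1 * C := by gcongr
        _ ≤ (Real.exp 1 * Real.exp (-(r ^ 2 / (4 * 4 ^ 0)))) * C := by gcongr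
        _ = _ := by simp; ring
    obtain ⟨k, hk1, hk2⟩ := exists_nat_pow_near h1 (by norm_num : (1 : ℝ) < 2)
    have hN1 := hN' h1
    have hmono : ∀ j : ℕ, (2 : ℝ) ^ j ≤ r → r ^ (-β) ≤ ((2 : ℝ) ^ j) ^ (-β) := fun j hj =>
      Real.rpow_le_rpow_of_nonpos (by positivity) hj (by linarith)
    -- Here `2 ^ k ≤ r < 2 ^ (k + 1)`. For `k ≤ K` the `k`-th Gaussian is at least `e⁻¹` at `r`,
    -- which accounts for the factor `e`. For `k > K` the `K`-th term suffices, its Gaussian being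
    -- the one on the left.
    rcases le_or_gt k K with hkK | hkK
    · refine ⟨k, Finset.mem_range.2 (by omega), ?_⟩
      calc _ ≤ Real.exp (-(r ^ 2 / (4 * 4 ^ K))) * (C * r ^ (-β)) := by gcongr
        _ ≤ 1 * (C * ((2 : ℝ) ^ k) ^ (-β)) := by gcongr ?_ * (_ * ?_); exact hmono k hk1
        _ ≤ (Real.exp 1 * Real.exp (-(r ^ 2 / (4 * 4 ^ k)))) * (C * ((2 : ℝ) ^ k) ^ (-β)) := by
          gcongr; exact hlow k hk2.le
        _ = _ := by ring
    · refine ⟨K, by simp, ?_⟩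
      have hK : (2 : ℝ) ^ K ≤ r := (pow_le_pow_right₀ (by norm_num) hkK.le).trans hk1
      calc _ ≤ Real.exp (-(r ^ 2 / (4 * 4 ^ K))) * (C * r ^ (-β)) := by gcongr
        _ ≤ Real.exp (-(r ^ 2 / (4 * 4 ^ K))) * (C * ((2 : ℝ) ^ K) ^ (-β)) := by
          gcongr _ * (_ * ?_); exact hmono K hK
        _ = 1 * (C * (((2 : ℝ) ^ K) ^ (-β) * Real.exp (-(r ^ 2 / (4 * 4 ^ K))))) := by ring
        _ ≤ Real.exp 1 * (C * (((2 : ℝ) ^ K) ^ (-β) * Real.exp (-(r ^ 2 / (4 * 4 ^ K))))) := by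
          gcongr; exact Real.one_le_exp zero_le_one
        _ = _ := by ring
  obtain ⟨k, hk, h⟩ := key
  refine h.trans ?_
  gcongr
  exact Finset.single_le_sum (f := fun k => ((2 : ℝ) ^ k) ^ (-β) * Real.exp (-(r ^ 2 / (4 * 4 ^ k))))
    (fun j _ => by positivity) hk

theorem four_pi_mul_four_pow_rpow (d k : ℕ) :
    (4 * Real.pi * 4 ^ k) ^ ((d : ℝ) / 2)
      = (4 * Real.pi) ^ ((d : ℝ) / 2) * ((2 : ℝ) ^ k) ^ (d : ℝ) := by
  rw [Real.mul_rpow (by positivity) (by positivity)]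
  congr 1
  have : (4 : ℝ) ^ k = ((2 : ℝ) ^ k) ^ (2 : ℝ) := by
    rw [Real.rpow_two, ← pow_mul, mul_comm, pow_mul]; norm_num
  rw [this, ← Real.rpow_mul (by positivity)]
  congr 1
  ring

/-- If `ν` has Fourier decay of order `β` and `μ` has Gaussian energies of order `α` with
`α + β > d`, then the law of `x - y - z` for `(x, y, z)` distributed by `μ × μ × ν` has the mass in
Gaussian neighbourhoods of the origin that a bounded density would give. -/
theorem exists_integral_exp_sub_sub_le (μ ν : Measure V) [IsFiniteMeasure μ] [IsFiniteMeasure ν]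
    {α β A B : ℝ} (hβ : 0 ≤ β) (hB : 0 ≤ B) (hαβ : (Module.finrank ℝ V : ℝ) < α + β)
    (hν : ∀ ξ : V, ‖charFun ν ξ‖ ≤ B) (hν' : ∀ ξ : V, 1 ≤ ‖ξ‖ → ‖charFun ν ξ‖ ≤ B * ‖ξ‖ ^ (-β))
    (hμ : ∀ k : ℕ, ∫ p, Real.exp (-(4 ^ k * ‖p.1 - p.2‖ ^ 2)) ∂(μ.prod μ)
      ≤ A * ((2 : ℝ) ^ k) ^ (-α)) :
    ∃ C : ℝ, 0 ≤ C ∧ ∀ K : ℕ,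
      ∫ p, Real.exp (-(4 ^ K * ‖p.1.1 - p.1.2 - p.2‖ ^ 2)) ∂((μ.prod μ).prod ν)
        ≤ C * ((2 : ℝ) ^ K) ^ (-(Module.finrank ℝ V : ℝ)) := by
  set d := Module.finrank ℝ V with hd
  -- The ratio of the dyadic series: block `k` contributes `2 ^ (kd)` from the Gaussian
  -- normalisation, `2 ^ (-kα)` from the energy and `2 ^ (-kβ)` from the decay of `ν`.
  set θ : ℝ := (2 : ℝ) ^ ((d : ℝ) - α - β) with hθ
  have hθ0 : 0 < θ := Real.rpow_pos_of_pos two_pos _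
  have hθ1 : θ < 1 := Real.rpow_lt_one_of_one_lt_of_neg (by norm_num) (by linarith)
  have hA : 0 ≤ A := by
    have := hμ 0
    simp only [pow_zero, Real.one_rpow, mul_one] at this
    exact (integral_nonneg fun p => (Real.exp_pos _).le).trans this
  refine ⟨B * Real.exp 1 * (A * (1 - θ)⁻¹), ?_, fun K => ?_⟩
  · have : 0 < 1 - θ := by linarith
    positivity
  -- The law of `x - y`; its characteristic function `|μ̂|²` is nonnegative.
  set κ := (μ.prod μ).map fun p => p.1 - p.2 with hκ
  have hκc : ∀ ξ, charFun κ ξ = ((‖charFun μ ξ‖ ^ 2 : ℝ) : ℂ) := by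
    intro ξ
    rw [hκ, charFun_map_sub, Complex.mul_conj, Complex.normSq_eq_norm_sq]
  have hq : ∀ k : ℕ, (0 : ℝ) < 4 ^ k := fun k => by positivity
  set P : ℝ := (4 * Real.pi) ^ ((d : ℝ) / 2) with hP
  have hP0 : 0 < P := Real.rpow_pos_of_pos (by positivity) _
  set T := ∫ p, Real.exp (-(4 ^ K * ‖p.1.1 - p.1.2 - p.2‖ ^ 2)) ∂((μ.prod μ).prod ν) with hT
  have hTρ : ∫ w, Real.exp (-(4 ^ K * ‖w‖ ^ 2)) ∂((κ.prod ν).map fun p => p.1 - p.2) = T := by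
    rw [integral_map (by fun_prop) (by fun_prop), hκ, hT,
      integral_prod _ ?_, integral_prod _ ?_, integral_map (by fun_prop) ?_]
    · have : StronglyMeasurable fun p : V × V => Real.exp (-(4 ^ K * ‖p.1 - p.2‖ ^ 2)) :=
        Continuous.stronglyMeasurable (by fun_prop)
      exact this.integral_prod_right.aestronglyMeasurable
    · refine Integrable.of_bound (C := 1) (by fun_prop) (Filter.Eventually.of_forall fun p => ?_)
      rw [Real.norm_eq_abs, abs_of_pos (Real.exp_pos _), Real.exp_le_one_iff]
      simp only [Left.neg_nonpos_iff]; positivity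
    · refine Integrable.of_bound (C := 1) (by fun_prop) (Filter.Eventually.of_forall fun p => ?_)
      rw [Real.norm_eq_abs, abs_of_pos (Real.exp_pos _), Real.exp_le_one_iff]
      simp only [Left.neg_nonpos_iff]; positivity
  have h1 := integral_exp_neg_norm_sq_mul_charFun ((κ.prod ν).map fun p => p.1 - p.2) (hq K)
  rw [hTρ] at h1
  have h2 : (4 * Real.pi * 4 ^ K) ^ ((d : ℝ) / 2) * T
      ≤ ∫ ξ : V, Real.exp (-(‖ξ‖ ^ 2 / (4 * 4 ^ K))) * (‖charFun μ ξ‖ ^ 2 * ‖charFun ν ξ‖) := by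
    have h3 := congrArg norm h1
    rw [Complex.norm_real, Real.norm_eq_abs] at h3
    refine (le_abs_self _).trans (h3.symm.le.trans ?_)
    refine (norm_integral_le_integral_norm _).trans (le_of_eq ?_)
    refine integral_congr_ae (Filter.Eventually.of_forall fun ξ => ?_)
    simp only [charFun_map_sub, hκc, norm_mul, RCLike.norm_conj, Complex.norm_real,
      Real.norm_eq_abs, Real.abs_exp, abs_pow, abs_norm]
  have h4 : ∫ ξ : V, Real.exp (-(‖ξ‖ ^ 2 / (4 * 4 ^ K))) * (‖charFun μ ξ‖ ^ 2 * ‖charFun ν ξ‖)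
      ≤ ∫ ξ : V, B * Real.exp 1 * ∑ k ∈ Finset.range (K + 1), ((2 : ℝ) ^ k) ^ (-β)
          * (Real.exp (-(‖ξ‖ ^ 2 / (4 * 4 ^ k))) * ‖charFun μ ξ‖ ^ 2) := by
    refine integral_mono_of_nonneg (Filter.Eventually.of_forall fun ξ => by positivity) ?_
      (Filter.Eventually.of_forall fun ξ => ?_)
    · exact (integrable_finsetSum _ fun k _ =>
        (integrable_exp_neg_mul_norm_charFun_sq μ (hq k)).const_mul _).const_mul _
    · have := exp_neg_mul_le_sum_dyadic hβ hB (norm_nonneg ξ) (hν ξ) (hν' ξ) K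
      calc _ = (Real.exp (-(‖ξ‖ ^ 2 / (4 * 4 ^ K))) * ‖charFun ν ξ‖) * ‖charFun μ ξ‖ ^ 2 := by
            ring
        _ ≤ _ := mul_le_mul_of_nonneg_right this (sq_nonneg _)
        _ = _ := by
          rw [mul_assoc, Finset.sum_mul]
          simp only [mul_assoc]
  rw [integral_const_mul, integral_finsetSum _ fun k _ =>
        (integrable_exp_neg_mul_norm_charFun_sq μ (hq k)).const_mul _] at h4
  simp_rw [integral_const_mul, integral_exp_neg_mul_norm_charFun_sq μ (hq _), ← hd,
    four_pi_mul_four_pow_rpow] at h4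
  rw [four_pi_mul_four_pow_rpow] at h2
  have h5 : ∑ k ∈ Finset.range (K + 1), ((2 : ℝ) ^ k) ^ (-β) * (P * ((2 : ℝ) ^ k) ^ (d : ℝ)
      * ∫ p, Real.exp (-(4 ^ k * ‖p.1 - p.2‖ ^ 2)) ∂(μ.prod μ)) ≤ P * (A * (1 - θ)⁻¹) := by
    calc _ ≤ ∑ k ∈ Finset.range (K + 1), P * A * θ ^ k := by
          refine Finset.sum_le_sum fun k _ => ?_
          calc _ ≤ ((2 : ℝ) ^ k) ^ (-β) * (P * ((2 : ℝ) ^ k) ^ (d : ℝ)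
                * (A * ((2 : ℝ) ^ k) ^ (-α))) := by gcongr; exact hμ k
            _ = P * A * (((2 : ℝ) ^ k) ^ (-β) * ((2 : ℝ) ^ k) ^ (d : ℝ)
                * ((2 : ℝ) ^ k) ^ (-α)) := by ring
            _ = _ := by
              rw [← Real.rpow_add (by positivity), ← Real.rpow_add (by positivity), hθ,
                ← Real.rpow_natCast, ← Real.rpow_natCast, ← Real.rpow_mul two_pos.le,
                ← Real.rpow_mul two_pos.le]
              congr 2
              ring
      _ = P * A * ∑ k ∈ Finset.range (K + 1), θ ^ k := by rw [Finset.mul_sum]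
      _ ≤ P * A * (1 - θ)⁻¹ := by
        gcongr
        rw [← tsum_geometric_of_lt_one hθ0.le hθ1]
        exact (summable_geometric_of_lt_one hθ0.le hθ1).sum_le_tsum _ fun k _ => by positivity
      _ = _ := by ring
  have h6 : P * ((2 : ℝ) ^ K) ^ (d : ℝ) * T ≤ B * Real.exp 1 * (P * (A * (1 - θ)⁻¹)) :=
    h2.trans (h4.trans (by gcongr))
  have hX : 0 < ((2 : ℝ) ^ K) ^ (d : ℝ) := by positivity
  rw [Real.rpow_neg (by positivity), ← div_eq_mul_inv, le_div_iff₀ hX]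
  refine le_of_mul_le_mul_left ?_ hP0
  calc P * (T * ((2 : ℝ) ^ K) ^ (d : ℝ)) = P * ((2 : ℝ) ^ K) ^ (d : ℝ) * T := by ring
    _ ≤ _ := h6
    _ = _ := by ring

end GaussianCorrelation

/-! ### Measures of bounded upper density -/

section Frostman

open MeasureTheory

variable {X : Type*} [MetricSpace X] [MeasurableSpace X]

theorem isFiniteMeasure_of_isCompact_of_closedBall_le {μ : Measure X} {E : Set X}
    (hE : IsCompact E) (hμE : μ Eᶜ = 0) {α C : ℝ}
    (hup : ∀ x ∈ E, ∀ δ : ℝ, 0 < δ → δ ≤ 1 →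
      μ (Metric.closedBall x δ) ≤ ENNReal.ofReal (C * δ ^ α)) : IsFiniteMeasure μ := by
  have hEfin : μ E < ⊤ := hE.measure_lt_top_of_nhdsWithin fun x hx =>
    ⟨Metric.closedBall x 1, mem_nhdsWithin_of_mem_nhds (Metric.closedBall_mem_nhds x one_pos),
      (hup x hx 1 one_pos le_rfl).trans_lt ENNReal.ofReal_lt_top⟩
  refine ⟨?_⟩
  rw [← Set.union_compl_self E]
  exact (measure_union_le _ _).trans_lt (by rw [hμE, add_zero]; exact hEfin)

variable [BorelSpace X]

theorem exp_neg_sq_le_exp_neg_floor (u : ℝ) (hu : 0 ≤ u) :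
    Real.exp (-u ^ 2) ≤ Real.exp (-1 * (⌊u⌋₊ : ℝ)) := by
  refine Real.exp_le_exp.2 ?_
  have h1 : (⌊u⌋₊ : ℝ) ≤ u := Nat.floor_le hu
  have h2 : (⌊u⌋₊ : ℝ) ≤ (⌊u⌋₊ : ℝ) ^ 2 := by exact_mod_cast Nat.le_self_pow two_ne_zero _
  have h3 : (⌊u⌋₊ : ℝ) ^ 2 ≤ u ^ 2 := by gcongr
  linarith

theorem summable_exp_neg_mul_rpow (α : ℝ) :
    Summable fun n : ℕ => Real.exp (-1 * (n : ℝ)) * ((n : ℝ) + 1) ^ α := by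
  have h := (summable_nat_add_iff 1).2 (Real.summable_pow_mul_exp_neg_nat_mul ⌈α⌉₊ one_pos)
  refine Summable.of_nonneg_of_le (fun n => by positivity) (fun n => ?_) (h.mul_left (Real.exp 1))
  have e : Real.exp 1 * (((n + 1 : ℕ) : ℝ) ^ ⌈α⌉₊ * Real.exp (-1 * ((n + 1 : ℕ) : ℝ)))
      = Real.exp (-1 * (n : ℝ)) * ((n : ℝ) + 1) ^ ⌈α⌉₊ := by
    have : Real.exp (-1 * (n : ℝ)) = Real.exp 1 * Real.exp (-1 * ((n + 1 : ℕ) : ℝ)) := by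
      rw [← Real.exp_add]; congr 1; push_cast; ring
    rw [this]; push_cast; ring
  rw [e, ← Real.rpow_natCast]
  gcongr
  · linarith [(Nat.cast_nonneg n : (0 : ℝ) ≤ n)]
  · exact Nat.le_ceil α

/-- The Gaussian potential of a measure with `μ (B(x, r)) ≤ B r ^ α`. -/
theorem integral_exp_neg_dist_sq_le {μ : Measure X} [IsFiniteMeasure μ] {α B : ℝ} (hB : 0 ≤ B)
    {x : X} (hx : ∀ r : ℝ, 0 < r → μ (Metric.closedBall x r) ≤ ENNReal.ofReal (B * r ^ α))
    {R : ℝ} (hR : 0 < R) :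
    ∫ y, Real.exp (-(R * dist x y) ^ 2) ∂μ
      ≤ (B * ∑' n : ℕ, Real.exp (-1 * (n : ℝ)) * ((n : ℝ) + 1) ^ α) * R ^ (-α) := by
  set S := ∑' n : ℕ, Real.exp (-1 * (n : ℝ)) * ((n : ℝ) + 1) ^ α with hS
  have hS0 : 0 ≤ S := tsum_nonneg fun n => by positivity
  rw [integral_eq_lintegral_of_nonneg_ae
    (Filter.Eventually.of_forall fun y => (Real.exp_pos _).le)
    (Continuous.aestronglyMeasurable (by fun_prop))]
  refine ENNReal.toReal_le_of_le_ofReal (by positivity) ?_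
  calc ∫⁻ y, ENNReal.ofReal (Real.exp (-(R * dist x y) ^ 2)) ∂μ
      ≤ ∫⁻ y, ∑' n : ℕ, (Metric.closedBall x (((n : ℝ) + 1) / R)).indicator
          (fun _ => ENNReal.ofReal (Real.exp (-1 * (n : ℝ)))) y ∂μ := by
        refine lintegral_mono fun y => ?_
        have hu : 0 ≤ R * dist x y := by positivity
        -- Each `y` is charged to the shell `n ≤ R dist x y < n + 1`, where the Gaussian is at most
        -- `e ^ (-n)`.
        refine le_trans ?_ (ENNReal.le_tsum ⌊R * dist x y⌋₊)
        rw [Set.indicator_of_mem]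
        · exact ENNReal.ofReal_le_ofReal (exp_neg_sq_le_exp_neg_floor _ hu)
        · rw [Metric.mem_closedBall, dist_comm, le_div_iff₀ hR, mul_comm]
          exact (Nat.lt_floor_add_one _).le
    _ = ∑' n : ℕ, ENNReal.ofReal (Real.exp (-1 * (n : ℝ)))
          * μ (Metric.closedBall x (((n : ℝ) + 1) / R)) := by
        rw [lintegral_tsum fun n =>
          (measurable_const.indicator Metric.isClosed_closedBall.measurableSet).aemeasurable]
        congr 1 with n
        rw [lintegral_indicator_const Metric.isClosed_closedBall.measurableSet]
    _ ≤ ∑' n : ℕ, ENNReal.ofReal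
          (B * R ^ (-α) * (Real.exp (-1 * (n : ℝ)) * ((n : ℝ) + 1) ^ α)) := by
        refine ENNReal.tsum_le_tsum fun n => ?_
        refine (mul_le_mul_right (hx _ (by positivity)) _).trans (le_of_eq ?_)
        rw [← ENNReal.ofReal_mul (Real.exp_pos _).le, Real.div_rpow (by positivity) hR.le,
          Real.rpow_neg hR.le]
        congr 1
        ring
    _ = _ := by
        rw [← ENNReal.ofReal_tsum_of_nonneg (fun n => by positivity)
          ((summable_exp_neg_mul_rpow α).mul_left _), tsum_mul_left, ← hS]
        congr 1
        ring

/-- The Gaussian energies of a compactly carried measure with `μ (B(x, r)) ≤ C r ^ α`. -/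
theorem exists_integral_exp_neg_dist_sq_le {μ : Measure X} [SecondCountableTopology X]
    [IsFiniteMeasure μ] {E : Set X}
    (hμE : μ Eᶜ = 0) {α C : ℝ} (hα : 0 ≤ α) (hC : 0 ≤ C)
    (hup : ∀ x ∈ E, ∀ δ : ℝ, 0 < δ → δ ≤ 1 →
      μ (Metric.closedBall x δ) ≤ ENNReal.ofReal (C * δ ^ α)) :
    ∃ A : ℝ, ∀ R : ℝ, 0 < R →
      ∫ p, Real.exp (-(R * dist p.1 p.2) ^ 2) ∂(μ.prod μ) ≤ A * R ^ (-α) := by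
  -- Adding the total mass extends the ball bound to radii above `1`, where `r ^ α ≥ 1`.
  set B := C + μ.real Set.univ with hB
  have hB0 : 0 ≤ B := by positivity
  have hball : ∀ x ∈ E, ∀ r : ℝ, 0 < r →
      μ (Metric.closedBall x r) ≤ ENNReal.ofReal (B * r ^ α) := by
    intro x hx r hr
    rcases le_total r 1 with h | h
    · refine (hup x hx r hr h).trans (ENNReal.ofReal_le_ofReal ?_)
      gcongr
      simp [hB]
    · refine (measure_mono (Set.subset_univ _)).trans ?_
      rw [← ofReal_measureReal]
      refine ENNReal.ofReal_le_ofReal ?_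
      have h1 : 1 ≤ r ^ α := Real.one_le_rpow h hα
      have h2 : μ.real Set.univ ≤ B := by simp [hB, hC]
      nlinarith
  set S := ∑' n : ℕ, Real.exp (-1 * (n : ℝ)) * ((n : ℝ) + 1) ^ α with hS
  refine ⟨μ.real Set.univ * (B * S), fun R hR => ?_⟩
  have hint : Integrable (fun p : X × X => Real.exp (-(R * dist p.1 p.2) ^ 2)) (μ.prod μ) := by
    refine Integrable.of_bound (C := 1) (Continuous.aestronglyMeasurable (by fun_prop))
      (Filter.Eventually.of_forall fun p => ?_)
    rw [Real.norm_eq_abs, abs_of_pos (Real.exp_pos _), Real.exp_le_one_iff]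
    simp only [Left.neg_nonpos_iff]; positivity
  rw [integral_prod _ hint]
  have hae : ∀ᵐ x ∂μ, x ∈ E := hμE
  calc _ ≤ ∫ _x, B * S * R ^ (-α) ∂μ := by
        refine integral_mono_ae hint.integral_prod_left (integrable_const _) ?_
        filter_upwards [hae] with x hx
        exact integral_exp_neg_dist_sq_le hB0 (hball x hx) hR
    _ = _ := by
        rw [integral_const, smul_eq_mul]; ring

end Frostman

/-! ### Counting separated pairs -/

section Counting

open MeasureTheory

theorem IsDerivChainOn.exists_norm_sub_le {V : Type*} [NormedAddCommGroup V] [NormedSpace ℝ V]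
    [CompleteSpace V] {F : ℕ → ℝ → V} {a b : ℝ} (hF : IsDerivChainOn F a b) :
    ∃ L : ℝ, 0 ≤ L ∧ ∀ s ∈ Set.Icc a b, ∀ s' ∈ Set.Icc a b, ‖F 0 s - F 0 s'‖ ≤ L * |s - s'| := by
  obtain ⟨L, hL⟩ := isCompact_Icc.exists_bound_of_continuousOn (hF 1).1
  have key : ∀ s ∈ Set.Icc a b, ∀ s' ∈ Set.Icc a b, s ≤ s' →
      ‖F 0 s' - F 0 s‖ ≤ |L| * |s' - s| := by
    intro s hs s' hs' hss
    rw [← (hF.mono hs.1 hs'.2).integral_eq_sub hss 0]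
    refine intervalIntegral.norm_integral_le_of_norm_le_const fun x hx => ?_
    rw [Set.uIoc_of_le hss] at hx
    exact (hL x ⟨hs.1.trans hx.1.le, hx.2.trans hs'.2⟩).trans (le_abs_self L)
  refine ⟨|L|, abs_nonneg _, fun s hs s' hs' => ?_⟩
  rcases le_total s s' with h | h
  · rw [norm_sub_rev, abs_sub_comm]; exact key s hs s' hs' h
  · exact key s' hs' s hs h

/-- One-sided intervals are used because `s₀` may be an endpoint. If there is no room on the right,
`2c ≤ b - a` leaves room on the left. -/
theorem exists_Icc_subset_of_mem {a b c s₀ : ℝ} (hs : s₀ ∈ Set.Icc a b) (hc : 0 ≤ c)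
    (hcb : 2 * c ≤ b - a) :
    ∃ u v, v - u = c ∧ Set.Icc u v ⊆ Set.Icc a b ∧ ∀ s ∈ Set.Icc u v, |s - s₀| ≤ c := by
  rcases le_total (s₀ + c) b with h | h
  · refine ⟨s₀, s₀ + c, by ring, Set.Icc_subset_Icc hs.1 h, fun s hs' => ?_⟩
    rw [abs_le]; constructor <;> linarith [hs'.1, hs'.2]
  · refine ⟨s₀ - c, s₀, by ring, Set.Icc_subset_Icc (by linarith) hs.2, fun s hs' => ?_⟩
    rw [abs_le]; constructor <;> linarith [hs'.1, hs'.2]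

variable {V : Type*} [NormedAddCommGroup V] [InnerProductSpace ℝ V]

/-- The occupation measure of a curve has Gaussian averages at least of the order of the scale near
the curve. -/
theorem le_setIntegral_exp_of_near {F : ℕ → ℝ → V} {a b L : ℝ} (hF : IsDerivChainOn F a b)
    (hL : 0 ≤ L)
    (hlip : ∀ s ∈ Set.Icc a b, ∀ s' ∈ Set.Icc a b, ‖F 0 s - F 0 s'‖ ≤ L * |s - s'|) {c R : ℝ}
    (hc : 0 ≤ c) (hc1 : c ≤ 1) (hcb : 2 * c ≤ b - a) (hR : 1 ≤ R) {s₀ : ℝ} (hs₀ : s₀ ∈ Set.Icc a b)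
    {w : V} (hw : ‖w - F 0 s₀‖ ≤ R⁻¹) :
    Real.exp (-(1 + L) ^ 2) * c * R⁻¹
      ≤ ∫ s in Set.Icc a b, Real.exp (-(R * ‖w - F 0 s‖) ^ 2) := by
  have hR0 : 0 < R := one_pos.trans_le hR
  have hRi : R⁻¹ ≤ 1 := inv_le_one_of_one_le₀ hR
  have hcR : 0 ≤ c * R⁻¹ := by positivity
  have hcRle : c * R⁻¹ ≤ c := mul_le_of_le_one_right hc hRi
  -- For parameters within `c / R ≤ 1 / R` of `s₀`, the curve is within `(1 + L) / R` of `w`.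
  obtain ⟨u, v, huv, hsub, hnear⟩ := exists_Icc_subset_of_mem hs₀ hcR (by linarith)
  have hcont : ContinuousOn (fun s => Real.exp (-(R * ‖w - F 0 s‖) ^ 2)) (Set.Icc a b) :=
    Real.continuous_exp.comp_continuousOn
      ((continuousOn_const.mul (continuousOn_const.sub (hF 0).1).norm).pow 2).neg
  have hint := hcont.integrableOn_Icc (μ := volume)
  calc _ = Real.exp (-(1 + L) ^ 2) * volume.real (Set.Icc u v) := by
        rw [Real.volume_real_Icc_of_le (by linarith), huv]; ring
    _ ≤ ∫ s in Set.Icc u v, Real.exp (-(R * ‖w - F 0 s‖) ^ 2) := by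
        refine setIntegral_ge_of_const_le_real measurableSet_Icc (by simp) (fun s hs => ?_)
          (hint.mono_set hsub)
        refine Real.exp_le_exp.2 (neg_le_neg ?_)
        gcongr
        have h1 : ‖w - F 0 s‖ ≤ R⁻¹ + L * R⁻¹ := by
          calc ‖w - F 0 s‖ ≤ ‖w - F 0 s₀‖ + ‖F 0 s - F 0 s₀‖ := by
                rw [norm_sub_rev (F 0 s)]; exact norm_sub_le_norm_sub_add_norm_sub _ _ _
            _ ≤ _ := by
                gcongr
                refine (hlip s (hsub hs) s₀ hs₀).trans ?_
                gcongr
                exact (hnear s hs).trans (mul_le_of_le_one_left (by positivity) hc1)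
        calc R * ‖w - F 0 s‖ ≤ R * (R⁻¹ + L * R⁻¹) := by gcongr
          _ = 1 + L := by field_simp
    _ ≤ _ := setIntegral_mono_set hint
        (Filter.Eventually.of_forall fun s => (Real.exp_pos _).le) hsub.eventuallyLE

/-- Separated sets of pairs in an Ahlfors-David regular set whose difference lies on a
non-degenerate curve. -/
theorem exists_card_separated_pairs_le [FiniteDimensional ℝ V] [MeasurableSpace V] [BorelSpace V]
    {E : Set V} (hE : IsCompact E) {μ : Measure V}
    (hμE : μ Eᶜ = 0) {α C : ℝ} (hC : 0 < C)
    (hreg : ∀ x ∈ E, ∀ δ : ℝ, 0 < δ → δ ≤ 1 →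
      ENNReal.ofReal (C⁻¹ * δ ^ α) ≤ μ (Metric.closedBall x δ) ∧
      μ (Metric.closedBall x δ) ≤ ENNReal.ofReal (C * δ ^ α))
    {F : ℕ → ℝ → V} {a b : ℝ} (hab : a < b) (hF : IsDerivChainOn F a b) {d : ℕ} (hd0 : 1 ≤ d)
    (hd : Module.finrank ℝ V = d)
    (hli : ∀ s ∈ Set.Icc a b, LinearIndependent ℝ (fun k : Fin d => F (k.val + 1) s))
    (hα : (d : ℝ) - 1 / d < α) :
    ∃ D : ℝ, 0 < D ∧ ∀ (K : ℕ) (S : Finset (V × V)),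
      (∀ p ∈ S, p.1 ∈ E ∧ p.2 ∈ E ∧ ∃ s ∈ Set.Icc a b, p.1 - p.2 = F 0 s) →
      (∀ p ∈ S, ∀ q ∈ S, p ≠ q → ((2 : ℝ) ^ K)⁻¹ < dist p q) →
      (S.card : ℝ) ≤ D * ((2 : ℝ) ^ K) ^ (2 * α - d + 1) := by
  have hd0' : (1 : ℝ) ≤ d := by exact_mod_cast hd0
  have hα0 : 0 ≤ α := by
    have : 1 / (d : ℝ) ≤ 1 := by rw [div_le_one (by positivity)]; exact hd0'
    linarith
  have : IsFiniteMeasure μ := isFiniteMeasure_of_isCompact_of_closedBall_le hE hμE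
    fun x hx δ h0 h1 => (hreg x hx δ h0 h1).2
  -- energy and decay
  obtain ⟨A, hA⟩ := exists_integral_exp_neg_dist_sq_le hμE hα0 hC.le
    fun x hx δ h0 h1 => (hreg x hx δ h0 h1).2
  obtain ⟨B, hB0, hB⟩ := exists_norm_curve_integral_le hab.le hF hd hli
  have hF0m : AEMeasurable (F 0) (volume.restrict (Set.Icc a b)) :=
    (hF 0).1.aemeasurable measurableSet_Icc
  set ν : Measure V := (volume.restrict (Set.Icc a b)).map (F 0) with hν
  have hνc : ∀ ξ : V, charFun ν ξ
      = ∫ s in a..b, Complex.exp ((inner ℝ (F 0 s) ξ : ℝ) * Complex.I) := by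
    intro ξ
    rw [charFun_apply, hν, integral_map hF0m (by fun_prop),
      intervalIntegral.integral_of_le hab.le, integral_Icc_eq_integral_Ioc]
  obtain ⟨C₁, hC₁, hT⟩ := exists_integral_exp_sub_sub_le μ ν (α := α) (β := 1 / (d : ℝ))
    (A := A) (B := B + (b - a)) (by positivity) (by linarith) (by rw [hd]; linarith)
    (fun ξ => by
      rw [hνc]
      exact (norm_oscillatory_integral_le hab.le).trans (by linarith))
    (fun ξ hξ => by
      rw [hνc]
      refine (hB ξ hξ).trans ?_
      gcongr
      linarith)
    (fun k => by
      have h := hA (2 ^ k) (by positivity)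
      refine le_trans (le_of_eq ?_) h
      congr 1 with p
      rw [mul_pow, dist_eq_norm, ← pow_mul, mul_comm k, pow_mul]
      norm_num)
  rw [hd] at hT
  obtain ⟨L, hL0, hL⟩ := hF.exists_norm_sub_le
  set c : ℝ := min 1 ((b - a) / 2) with hc
  have hc0 : 0 < c := lt_min one_pos (by linarith)
  set e : ℝ := Real.exp (-(1 + L) ^ 2) * c with he
  have he0 : 0 < e := by positivity
  set η : ℝ := (C⁻¹ * (1 / 2 : ℝ) ^ α) ^ 2 with hη
  have hη0 : 0 < η := by positivity
  -- The `+ 1` only ensures positivity, since `C₁` may vanish.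
  refine ⟨C₁ / (e * η) + 1, by positivity, fun K S hS hsep => ?_⟩
  set R : ℝ := (2 : ℝ) ^ K with hR
  have hR1 : 1 ≤ R := one_le_pow₀ (by norm_num)
  have hR0 : 0 < R := one_pos.trans_le hR1
  set g : V × V → ℝ := fun p => ∫ s in Set.Icc a b, Real.exp (-(R * ‖p.1 - p.2 - F 0 s‖) ^ 2)
    with hg
  have hRK : (4 : ℝ) ^ K = R ^ 2 := by
    rw [hR, ← pow_mul, mul_comm, pow_mul]; norm_num
  have hint : Integrable (fun p : (V × V) × V =>
      Real.exp (-(4 ^ K * ‖p.1.1 - p.1.2 - p.2‖ ^ 2))) ((μ.prod μ).prod ν) := by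
    refine Integrable.of_bound (C := 1) (Continuous.aestronglyMeasurable (by fun_prop))
      (Filter.Eventually.of_forall fun p => ?_)
    rw [Real.norm_eq_abs, abs_of_pos (Real.exp_pos _), Real.exp_le_one_iff]
    simp only [Left.neg_nonpos_iff]; positivity
  have hgν : (fun p : V × V => ∫ z, Real.exp (-(4 ^ K * ‖p.1 - p.2 - z‖ ^ 2)) ∂ν) = g := by
    funext p
    rw [hν, integral_map hF0m (Continuous.aestronglyMeasurable (by fun_prop))]
    simp only [hg, mul_pow, hRK]
  have hgint : Integrable g (μ.prod μ) := hgν ▸ hint.integral_prod_left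
  have hgT : ∫ p, g p ∂(μ.prod μ) ≤ C₁ * R ^ (-(d : ℝ)) := by
    have h := hT K
    rw [integral_prod _ hint] at h
    rwa [hgν] at h
  -- Markov's inequality: the pairs within `1/R` of the curve lie in a superlevel set of `g`, so
  -- their mass is `≲ R · R ^ (-d)`.
  have hmk := mul_meas_ge_le_integral_of_nonneg (μ := μ.prod μ) (f := g)
    (Filter.Eventually.of_forall fun p => integral_nonneg fun s => (Real.exp_pos _).le)
    hgint (e * R⁻¹)
  have hRhalf : R⁻¹ / 2 ≤ 1 := by
    have := inv_le_one_of_one_le₀ hR1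
    linarith
  -- In the sup metric of the product, moving both points by `1/(2R)` moves their difference by at
  -- most `1/R`.
  have hsubset : (⋃ p ∈ S, Metric.closedBall p (R⁻¹ / 2)) ⊆ {p | e * R⁻¹ ≤ g p} := by
    intro q hq
    obtain ⟨p, hp, hqp⟩ := Set.mem_iUnion₂.1 hq
    obtain ⟨-, -, s₀, hs₀, hps⟩ := hS p hp
    rw [← closedBall_prod_same, Set.mem_prod, mem_closedBall_iff_norm, mem_closedBall_iff_norm]
      at hqp
    refine le_setIntegral_exp_of_near hF hL0 hL hc0.le (min_le_left _ _) ?_ hR1 hs₀ ?_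
    · have := min_le_right 1 ((b - a) / 2)
      linarith
    · rw [← hps]
      calc ‖q.1 - q.2 - (p.1 - p.2)‖ = ‖(q.1 - p.1) - (q.2 - p.2)‖ := by congr 1; abel
        _ ≤ R⁻¹ / 2 + R⁻¹ / 2 := (norm_sub_le _ _).trans (add_le_add hqp.1 hqp.2)
        _ = R⁻¹ := by ring
  have hball : ∀ p ∈ S, η * R ^ (-(2 * α)) ≤ (μ.prod μ).real (Metric.closedBall p (R⁻¹ / 2)) := by
    intro p hp
    obtain ⟨h1, h2, -⟩ := hS p hp
    have hr : 0 < R⁻¹ / 2 := by positivity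
    have hlow : ∀ x ∈ E, C⁻¹ * (R⁻¹ / 2) ^ α ≤ μ.real (Metric.closedBall x (R⁻¹ / 2)) := by
      intro x hx
      exact (ENNReal.ofReal_le_iff_le_toReal (measure_ne_top _ _)).1 (hreg x hx _ hr hRhalf).1
    rw [← closedBall_prod_same, measureReal_prod_prod]
    have hsq : η * R ^ (-(2 * α)) = (C⁻¹ * (R⁻¹ / 2) ^ α) * (C⁻¹ * (R⁻¹ / 2) ^ α) := by
      have e1 : R⁻¹ / 2 = R⁻¹ * (1 / 2) := by ring
      have e2 : R ^ (-(2 * α)) = R⁻¹ ^ α * R⁻¹ ^ α := by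
        rw [Real.inv_rpow hR0.le, ← Real.rpow_neg hR0.le, ← Real.rpow_add hR0]
        congr 1; ring
      rw [hη, e1, Real.mul_rpow (by positivity) (by positivity), e2]
      ring
    rw [hsq]
    exact mul_le_mul (hlow _ h1) (hlow _ h2) (by positivity) measureReal_nonneg
  have hdisj : (S : Set (V × V)).PairwiseDisjoint fun p => Metric.closedBall p (R⁻¹ / 2) := by
    intro p hp q hq hpq
    exact Metric.closedBall_disjoint_closedBall (by
      have := hsep p hp q hq hpq
      linarith)
  have hcount : (S.card : ℝ) * (η * R ^ (-(2 * α))) ≤ (μ.prod μ).real {p | e * R⁻¹ ≤ g p} := by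
    calc _ = ∑ _p ∈ S, η * R ^ (-(2 * α)) := by rw [Finset.sum_const, nsmul_eq_mul]
      _ ≤ ∑ p ∈ S, (μ.prod μ).real (Metric.closedBall p (R⁻¹ / 2)) := Finset.sum_le_sum hball
      _ = (μ.prod μ).real (⋃ p ∈ S, Metric.closedBall p (R⁻¹ / 2)) :=
          (measureReal_biUnion_finset hdisj
            fun p _ => Metric.isClosed_closedBall.measurableSet).symm
      _ ≤ _ := measureReal_mono hsubset
  have hfin : e * R⁻¹ * ((S.card : ℝ) * (η * R ^ (-(2 * α)))) ≤ C₁ * R ^ (-(d : ℝ)) :=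
    (mul_le_mul_of_nonneg_left hcount (by positivity)).trans (hmk.trans hgT)
  have hsplit : R ^ (2 * α - d + 1) * R⁻¹ * R ^ (-(2 * α)) = R ^ (-(d : ℝ)) := by
    rw [← Real.rpow_neg_one R, ← Real.rpow_add hR0, ← Real.rpow_add hR0]
    congr 1; ring
  have hpos : 0 < e * η * (R⁻¹ * R ^ (-(2 * α))) := by positivity
  have hmain : (S.card : ℝ) ≤ C₁ / (e * η) * R ^ (2 * α - d + 1) := by
    refine le_of_mul_le_mul_left ?_ hpos
    calc _ = e * R⁻¹ * ((S.card : ℝ) * (η * R ^ (-(2 * α)))) := by ring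
      _ ≤ C₁ * R ^ (-(d : ℝ)) := hfin
      _ = _ := by rw [← hsplit]; field_simp
  refine hmain.trans ?_
  gcongr
  linarith

end Counting

/-! ### Covering numbers and the upper Minkowski dimension -/

/-- After division by `log (1 / ε)` the constant contributes `log D / log (1 / ε)`, which tends to
`0`. -/
theorem upperMinkowskiDim_le_of_coveringNumber_le {X : Type*} [PseudoEMetricSpace X] {A : Set X}
    {D σ : ℝ} (hD : 0 < D)
    (h : ∀ ε : ℝ≥0, 0 < ε → ε < 1 →
      ((Metric.coveringNumber ε A : ℕ∞) : ℝ≥0∞) ≤ ENNReal.ofReal (D * (1 / (ε : ℝ)) ^ σ)) :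
    upperMinkowskiDim A ≤ (σ : EReal) := by
  have hlog : Filter.Tendsto (fun ε : ℝ≥0 => Real.log (1 / (ε : ℝ))) (𝓝[>] 0) Filter.atTop := by
    have h1 : Filter.Tendsto (fun ε : ℝ≥0 => (ε : ℝ)) (𝓝[>] 0) (𝓝[>] 0) := by
      refine tendsto_nhdsWithin_iff.2 ⟨?_, ?_⟩
      · exact (NNReal.continuous_coe.tendsto' 0 0 (by simp)).mono_left nhdsWithin_le_nhds
      · filter_upwards [self_mem_nhdsWithin] with ε hε
        exact NNReal.coe_pos.2 hε
    have h2 := (tendsto_inv_nhdsGT_zero (𝕜 := ℝ)).comp h1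
    simpa [Function.comp_def] using Real.tendsto_log_atTop.comp h2
  have hlim : Filter.Tendsto
      (fun ε : ℝ≥0 => (((Real.log D / Real.log (1 / (ε : ℝ)) + σ : ℝ)) : EReal)) (𝓝[>] 0)
      (𝓝 (σ : EReal)) := by
    rw [EReal.tendsto_coe]
    simpa using (hlog.const_div_atTop (Real.log D)).add_const σ
  have hne : (𝓝[>] (0 : ℝ≥0)).NeBot := inferInstance
  rw [← hlim.limsup_eq]
  refine Filter.limsup_le_limsup ?_
  filter_upwards [Ioo_mem_nhdsGT (zero_lt_one' ℝ≥0)] with ε hε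
  have hε0 : (0 : ℝ) < ε := NNReal.coe_pos.2 hε.1
  have hε1 : (ε : ℝ) < 1 := by exact_mod_cast hε.2
  have hL : 0 < Real.log (1 / (ε : ℝ)) := Real.log_pos (by rw [lt_div_iff₀ hε0]; linarith)
  have hle := ENNReal.log_le_log (h ε hε.1 hε.2)
  rw [ENNReal.log_ofReal_of_pos (by positivity), Real.log_mul hD.ne' (by positivity),
    Real.log_rpow (by positivity)] at hle
  refine (EReal.div_le_div_right_of_nonneg (by exact_mod_cast hL.le) hle).trans (le_of_eq ?_)
  rw [← EReal.coe_div]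
  congr 1
  field_simp

/-- The covering number is at most the packing number, so only finite separated sets need counting.
-/
theorem coveringNumber_le_ofReal_of_forall_card_le {X : Type*} [PseudoMetricSpace X] {A : Set X}
    {ε : ℝ≥0} {N : ℝ}
    (h : ∀ S : Finset X, (S : Set X) ⊆ A → (∀ p ∈ S, ∀ q ∈ S, p ≠ q → (ε : ℝ) < dist p q) →
      (S.card : ℝ) ≤ N) :
    ((Metric.coveringNumber ε A : ℕ∞) : ℝ≥0∞) ≤ ENNReal.ofReal N := by
  have hN : 0 ≤ N := by simpa using h ∅ (by simp) (by simp)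
  have hpack : Metric.packingNumber ε A ≤ (⌊N⌋₊ : ℕ∞) := by
    refine iSup₂_le fun C hC => iSup_le fun hsep => ?_
    by_contra hlt
    -- A separated set may be infinite a priori, so `⌊N⌋ + 1` of its points are extracted to
    -- contradict the bound.
    obtain ⟨T, hTC, hT⟩ := Set.exists_subset_encard_eq (s := C) (k := ((⌊N⌋₊ + 1 : ℕ) : ℕ∞))
      (by push_cast; exact Order.add_one_le_of_lt (not_le.1 hlt))
    have hfin : T.Finite := Set.finite_of_encard_eq_coe hT
    have hcard := h hfin.toFinset (by simpa using hTC.trans hC) fun p hp q hq hpq => by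
      have := hsep (hTC (hfin.mem_toFinset.1 hp)) (hTC (hfin.mem_toFinset.1 hq)) hpq
      simp only [edist_nndist, ENNReal.coe_lt_coe] at this
      exact_mod_cast this
    rw [hfin.encard_eq_coe_toFinset_card] at hT
    have hT' : hfin.toFinset.card = ⌊N⌋₊ + 1 := by exact_mod_cast hT
    rw [hT'] at hcard
    push_cast at hcard
    linarith [Nat.lt_floor_add_one N]
  have := (Metric.coveringNumber_le_packingNumber ε A).trans hpack
  calc ((Metric.coveringNumber ε A : ℕ∞) : ℝ≥0∞) ≤ (((⌊N⌋₊ : ℕ) : ℕ∞) : ℝ≥0∞) :=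
        ENat.toENNReal_le.2 this
    _ = ((⌊N⌋₊ : ℕ) : ℝ≥0∞) := by simp
    _ ≤ ENNReal.ofReal N := by
        rw [← ENNReal.ofReal_natCast]
        exact ENNReal.ofReal_le_ofReal (Nat.floor_le hN)

/-- Dyadic scales suffice to bound the upper Minkowski dimension. -/
theorem upperMinkowskiDim_le_of_dyadic {X : Type*} [PseudoMetricSpace X] {A : Set X}
    {D σ : ℝ} (hD : 0 < D) (hσ : 0 ≤ σ)
    (h : ∀ (K : ℕ) (S : Finset X), (S : Set X) ⊆ A →
      (∀ p ∈ S, ∀ q ∈ S, p ≠ q → ((2 : ℝ) ^ K)⁻¹ < dist p q) →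
      (S.card : ℝ) ≤ D * ((2 : ℝ) ^ K) ^ σ) :
    upperMinkowskiDim A ≤ (σ : EReal) := by
  -- An `ε`-separated set is separated at the next smaller dyadic scale `2 ^ (-(K + 1))`, which
  -- exceeds `ε / 2` up to equality; this costs `2 ^ σ`.
  refine upperMinkowskiDim_le_of_coveringNumber_le (D := D * 2 ^ σ) (by positivity)
    fun ε hε0 hε1 => ?_
  have hε0' : (0 : ℝ) < ε := NNReal.coe_pos.2 hε0
  have hε1' : (ε : ℝ) < 1 := by exact_mod_cast hε1
  obtain ⟨K, hK1, hK2⟩ := exists_nat_pow_near (x := 1 / (ε : ℝ)) (y := 2)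
    (by rw [le_div_iff₀ hε0']; linarith) (by norm_num)
  refine coveringNumber_le_ofReal_of_forall_card_le fun S hSA hsep => ?_
  have hle : ((2 : ℝ) ^ (K + 1))⁻¹ ≤ ε := by
    rw [inv_le_comm₀ (by positivity) hε0', ← one_div]
    exact hK2.le
  calc (S.card : ℝ) ≤ D * ((2 : ℝ) ^ (K + 1)) ^ σ :=
        h (K + 1) S hSA fun p hp q hq hpq => hle.trans_lt (hsep p hp q hq hpq)
    _ = D * (2 * 2 ^ K) ^ σ := by rw [pow_succ']
    _ ≤ D * (2 * (1 / (ε : ℝ))) ^ σ := by gcongr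
    _ = D * 2 ^ σ * (1 / (ε : ℝ)) ^ σ := by
        rw [Real.mul_rpow (by norm_num) (by positivity)]; ring

/-! ### Curves on closed intervals -/

/-- A bounded part of a closed interval of positive length lies in a compact subinterval of
positive length. -/
theorem exists_Icc_subset_inter_Icc_subset {I : Set ℝ} (hI : I.OrdConnected) (hc : IsClosed I)
    (hne : (interior I).Nonempty) (R : ℝ) :
    ∃ a b, a < b ∧ Set.Icc a b ⊆ I ∧ I ∩ Set.Icc (-R) R ⊆ Set.Icc a b := by
  obtain ⟨x, hx⟩ := hne
  obtain ⟨y, hxy, hy⟩ : ∃ y, x < y ∧ y ∈ I := by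
    have : ∀ᶠ y in 𝓝[>] x, y ∈ I :=
      nhdsWithin_le_nhds (mem_interior_iff_mem_nhds.1 hx)
    obtain ⟨y, hy, hxy⟩ := (this.and self_mem_nhdsWithin).exists
    exact ⟨y, hxy, hy⟩
  have hxI : x ∈ I := interior_subset hx
  -- Including `x` and `y` keeps the truncated interval of positive length.
  set M := |R| + |x| + |y| with hM
  set J := I ∩ Set.Icc (-M) M with hJ
  have hJc : IsCompact J := isCompact_Icc.inter_left hc
  have hJo : J.OrdConnected := hI.inter Set.ordConnected_Icc
  have hxJ : x ∈ J := ⟨hxI, by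
    constructor <;> linarith [neg_abs_le x, le_abs_self x, abs_nonneg R, abs_nonneg y]⟩
  have hyJ : y ∈ J := ⟨hy, by
    constructor <;> linarith [neg_abs_le y, le_abs_self y, abs_nonneg R, abs_nonneg x]⟩
  have hJe := eq_Icc_of_connected_compact ⟨⟨x, hxJ⟩, hJo.isPreconnected⟩ hJc
  refine ⟨sInf J, sSup J, ?_, ?_, ?_⟩
  · exact (csInf_le hJc.bddBelow hxJ).trans_lt (hxy.trans_le (le_csSup hJc.bddAbove hyJ))
  · rw [← hJe]; exact Set.inter_subset_left
  · rw [← hJe]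
    refine Set.inter_subset_inter_right _ (Set.Icc_subset_Icc ?_ ?_) <;>
      linarith [le_abs_self R, abs_nonneg x, abs_nonneg y]

/-- At points of the open interval `I` is a neighbourhood, so derivatives within `I` are genuine; at
the endpoints a chain asks only for continuity. -/
theorem isDerivChainOn_iteratedDerivWithin {V : Type*} [NormedAddCommGroup V] [NormedSpace ℝ V]
    {f : ℝ → V} {I : Set ℝ} {a b : ℝ} (hf : ContDiffOn ℝ ∞ f I) (hI : UniqueDiffOn ℝ I)
    (hab : Set.Icc a b ⊆ I) : IsDerivChainOn (fun k => iteratedDerivWithin k f I) a b := by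
  intro k
  refine ⟨(hf.continuousOn_iteratedDerivWithin (by exact_mod_cast le_top) hI).mono hab,
    fun s hs => ?_⟩
  have hnhds : I ∈ 𝓝 s := Filter.mem_of_superset (Icc_mem_nhds hs.1 hs.2) hab
  have h := (hf.differentiableOn_iteratedDerivWithin
    (m := k) (by exact_mod_cast ENat.natCast_lt_top k) hI s (mem_of_mem_nhds hnhds)).hasDerivWithinAt
  simp only [iteratedDerivWithin_succ]
  exact h.hasDerivAt hnhds

theorem contDiffOn_graphCurve {m : ℕ} {γ : Fin m → ℝ → ℝ} {I : Set ℝ}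
    (hγ : ∀ l, ContDiffOn ℝ ∞ (γ l) I) : ContDiffOn ℝ ∞ (graphCurve γ) I := by
  rw [contDiffOn_euclidean]
  intro i
  refine Fin.cases ?_ (fun l => ?_) i
  · simp only [graphCurve, Fin.cons_zero]
    exact contDiffOn_id
  · simpa [graphCurve] using hγ l

theorem sub_eq_add_graphCurve_of_mem_curvePairs {m : ℕ} {I : Set ℝ} {γ : Fin m → ℝ → ℝ}
    {t : Fin m → ℝ} {E : Set (EuclideanSpace ℝ (Fin (m + 1)))}
    {p : EuclideanSpace ℝ (Fin (m + 1)) × EuclideanSpace ℝ (Fin (m + 1))}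
    (hp : p ∈ curvePairs I γ t E) :
    p.1 - p.2 = WithLp.toLp 2 (Fin.cons 0 t : Fin (m + 1) → ℝ) + graphCurve γ (p.1 0 - p.2 0) := by
  ext i
  refine Fin.cases ?_ (fun l => ?_) i
  · simp [graphCurve]
  · have := hp.2.2.2 l
    simp only [curvePhi] at this
    simp [graphCurve]
    linarith

/-- The ambient dimension is `d = m + 1`; `I` is a closed interval of positive length, such as
`[0, 1]` or the whole line. -/
theorem corollary1p5 (m : ℕ) (hm : 1 ≤ m)
    (I : Set ℝ) (hI_int : I.OrdConnected) (hI_closed : IsClosed I) (hI_pos : (interior I).Nonempty)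
    (γ : Fin m → ℝ → ℝ) (hγ : ∀ l, ContDiffOn ℝ ∞ (γ l) I)
    (hΓ : HasNonvanishingCurvatureAndTorsionOn (graphCurve γ) I)
    (E : Set (EuclideanSpace ℝ (Fin (m + 1)))) (hE : IsCompact E)
    (hE_reg : IsAhlforsDavidRegular E)
    (hdim : ((m : ℝ) + 1) - 1 / ((m : ℝ) + 1) < (dimH E).toReal)
    (t : Fin m → ℝ) :
    upperMinkowskiDim (curvePairs I γ t E) ≤ ((2 * (dimH E).toReal - (m : ℝ) : ℝ) : EReal) := by
  obtain ⟨μ, hμE, C, hC, hreg⟩ := hE_reg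
  set α := (dimH E).toReal with hα
  obtain ⟨R, hR⟩ := hE.isBounded.exists_norm_le
  obtain ⟨a, b, hab, habI, hIab⟩ :=
    -- Points of `E` have norm at most `R`, so `x 0 - y 0` lies in `[-2R, 2R]`.
    exists_Icc_subset_inter_Icc_subset hI_int hI_closed hI_pos (R + R)
  have hI : UniqueDiffOn ℝ I := uniqueDiffOn_convex hI_int.convex hI_pos
  set τ : EuclideanSpace ℝ (Fin (m + 1)) := WithLp.toLp 2 (Fin.cons 0 t : Fin (m + 1) → ℝ) with hτ
  set F : ℕ → ℝ → EuclideanSpace ℝ (Fin (m + 1)) :=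
    fun k => iteratedDerivWithin k (fun s => τ + graphCurve γ s) I with hF
  have hFc : IsDerivChainOn F a b := isDerivChainOn_iteratedDerivWithin
    (contDiffOn_const.add (contDiffOn_graphCurve hγ)) hI habI
  have hli : ∀ s ∈ Set.Icc a b,
      LinearIndependent ℝ (fun k : Fin (m + 1) => F (k.val + 1) s) := by
    intro s hs
    have := hΓ s (habI hs)
    simpa only [hF, iteratedDerivWithin_const_add (Nat.succ_pos _)] using this
  obtain ⟨D, hD, hcard⟩ := exists_card_separated_pairs_le hE hμE hC hreg hab hFc
    (Nat.le_add_left 1 m) (by simp) hli (by push_cast; exact hdim)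
  have hm1 : (1 : ℝ) ≤ m := by exact_mod_cast hm
  have hσ : 0 ≤ 2 * α - m := by
    have : 1 / ((m : ℝ) + 1) ≤ 1 := by rw [div_le_one (by positivity)]; linarith
    linarith
  refine upperMinkowskiDim_le_of_dyadic hD hσ fun K S hS hsep => ?_
  have h := hcard K S (fun p hp => ?_) hsep
  · refine h.trans (le_of_eq ?_)
    congr 2
    push_cast
    ring
  · have hpS := hS hp
    refine ⟨hpS.1, hpS.2.1, p.1 0 - p.2 0, hIab ⟨hpS.2.2.1, ?_⟩, ?_⟩
    · have h1 : ‖p.1 0‖ ≤ R := (PiLp.norm_apply_le p.1 0).trans (hR _ hpS.1)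
      have h2 : ‖p.2 0‖ ≤ R := (PiLp.norm_apply_le p.2 0).trans (hR _ hpS.2.1)
      rw [Real.norm_eq_abs, abs_le] at h1 h2
      constructor <;> linarith [h1.1, h1.2, h2.1, h2.2]
    · simpa only [hF, iteratedDerivWithin_zero] using sub_eq_add_graphCurve_of_mem_curvePairs hpS
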